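/- Let $\mathbb{K}$ be a commutative ring with unity; algebras are associative but need not have a unity. Definitions. A $\mathbb{K}$-algebra with enough idempotents is a pair $(R,\{e_i\}_{i\in I})$ in which the $e_i$ are orthogonal idempotents of the $\mathbb{K}$-algebra $R$ and $R=\bigoplus_{i\in I}e_iR=\bigoplus_{i\in I}Re_i$. It is basic if each $e_jRe_i$ is a $\mathbb{K}$-module of finite length, each $e_i$ is primitive, and $Re_i\not\simeq Re_j$ as left $R$-modules whenever $e_i\neq e_j$. A partition $\tilde{\mathcal A}=\{\tilde{\mathcal A}_i\}_{i<\alpha}$ of $I$ is a family of non-empty, pairwise disjoint subsets with union $I$, indexed by the ordinals $i<\alpha$, for some ordinal $\alpha$. For $i<\alpha$ and $t\in\tilde{\mathcal A}_i$ put $$\tau_t(i):=\mathrm{Tr}_{\bigoplus_{j<i}\bigoplus_{r\in\tilde{\mathcal A}_j}Re_r}(Re_t),\qquad \Delta_t(i):=Re_t/\tau_t(i),$$ where $\mathrm{Tr}_X(Y)$ is the sum of the images of all morphisms $X\to Y$ of left $R$-modules. Put $\Delta(i)=\{\Delta_t(i)\}_{t\in\tilde{\mathcal A}_i}$ and ${}_{\tilde{\mathcal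 A}}\Delta=\bigcup_{i<\alpha}\Delta(i)$. For a class $\Theta$ of modules, $\mathcal F_f(\Theta)$ is the class of modules $X$ that have a finite chain of submodules $0=X_0\subseteq X_1\subseteq\dots\subseteq X_n=X$ ($n\ge 0$) with each $X_k/X_{k-1}$ isomorphic to a member of $\Theta$. For $(R,\{e_i\}_{i\in I})$ basic, the pair $(R,\tilde{\mathcal A})$ is left standardly stratified if $\tau_t(i)\in\mathcal F_f(\bigcup_{j<i}\Delta(j))$ for all $i<\alpha$ and $t\in\tilde{\mathcal A}_i$. Theorem. Let $(U,\{e_i\}_{i\in I})$ and $(T,\{f_j\}_{j\in J})$ be basic $\mathbb{K}$-algebras with enough idempotents, and let $M$ be a $U$-$T$-bimodule on which $\mathbb{K}$ acts centrally, with $UM=M=MT$, such that $e_iMf_j$ is a $\mathbb{K}$-module of finite length for all $i\in I$, $j\in J$. Let $\tilde{\mathcal A}=\{\tilde{\mathcal A}_i\}_{i<\alpha}$ be a partition of $I$ and $\tilde{\mathcal B}=\{\tilde{\mathcal B}_j\}_{j<\beta}$ a partition of $J$, and let $\tilde{\mathcal C}=\tilde{\mathcal A}\vee\tilde{\mathcal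 B}$ be the partition of the disjoint union $I\vee J$ whose blocks are first the $\tilde{\mathcal A}_i$ $(i<\alpha)$, in their order, and then the $\tilde{\mathcal B}_j$ $(j<\beta)$, in their order (so it is indexed by $[0,\alpha)\vee[0,\beta)$, of order type $\alpha+\beta$). Let $\Lambda=\left[\begin{smallmatrix}T&0\\M&U\end{smallmatrix}\right]$ be the lower triangular matrix algebra, with the family $\{g_r\}_{r\in I\vee J}$ given by $g_i=\left[\begin{smallmatrix}0&0\\0&e_i\end{smallmatrix}\right]$ for $i\in I$ and $g_j=\left[\begin{smallmatrix}f_j&0\\0&0\end{smallmatrix}\right]$ for $j\in J$. Then $(\Lambda,\{g_r\}_{r\in I\vee J})$ is a basic $\mathbb{K}$-algebra with enough idempotents, and the following statements are equivalent: (a) $(\Lambda,\tilde{\mathcal C})$ is left standardly stratified; (b) $Mf_j\in\mathcal F_f({}_{\tilde{\mathcal A}}\Delta)$ for all $j\in J$, and $(T,\tilde{\mathcal B})$ and $(U,\tilde{\mathcal A})$ are left standardly stratified. -/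

import Mathlib

namespace EnoughIdem

/-! Modules over rings that need not have a unit. -/

/-- A left module over a ring that need not have a unit; no unitarity is required.
A right `T`-module is a left module over `Tᵐᵒᵖ`. -/
class NUModule (R : Type*) (M : Type*) [NonUnitalRing R] [AddCommGroup M] extends
    DistribSMul R M where
  add_smul : ∀ (r s : R) (x : M), (r + s) • x = r • x + s • x
  mul_smul : ∀ (r s : R) (x : M), (r * s) • x = r • (s • x)

instance instNUModuleSelf (R : Type*) [NonUnitalRing R] : NUModule R R where
  add_smul r s x := add_mul r s x
  mul_smul r s x := mul_assoc r s x

/-- `M` is unitary: `R M = M`. -/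
def IsUnitary (R : Type*) (M : Type*) [NonUnitalRing R] [AddCommGroup M] [NUModule R M] : Prop :=
  AddSubgroup.closure {x : M | ∃ (r : R) (m : M), x = r • m} = ⊤

/-- Submodules of a module over a ring that need not have a unit. -/
structure NUSubmodule (R : Type*) (M : Type*) [NonUnitalRing R] [AddCommGroup M]
    [NUModule R M] extends AddSubgroup M where
  smul_mem : ∀ (r : R) {x : M}, x ∈ carrier → r • x ∈ carrier

section Modules

variable {R : Type*} [NonUnitalRing R]
variable {M : Type*} [AddCommGroup M] [NUModule R M]
variable {N : Type*} [AddCommGroup N] [NUModule R N]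

/-- The underlying type of a submodule. -/
abbrev NUSubmodule.Carrier (L : NUSubmodule R M) : Type _ := L.toAddSubgroup

instance NUSubmodule.instNUModule (L : NUSubmodule R M) : NUModule R L.Carrier where
  smul r x := ⟨r • (x : M), L.smul_mem r x.2⟩
  smul_zero r := Subtype.ext (smul_zero r)
  smul_add r x y := Subtype.ext (smul_add r (x : M) (y : M))
  add_smul r s x := Subtype.ext (NUModule.add_smul r s (x : M))
  mul_smul r s x := Subtype.ext (NUModule.mul_smul r s (x : M))

@[simp] theorem NUSubmodule.coe_smul (L : NUSubmodule R M) (r : R) (x : L.Carrier) :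
    ((r • x : L.Carrier) : M) = r • (x : M) := rfl

/-- The quotient of a module by a submodule. -/
abbrev NUSubmodule.Quot (L : NUSubmodule R M) : Type _ := M ⧸ L.toAddSubgroup

/-- Multiplication by `r` on a quotient module. -/
def NUSubmodule.quotSmul (L : NUSubmodule R M) (r : R) : L.Quot →+ L.Quot :=
  QuotientAddGroup.map L.toAddSubgroup L.toAddSubgroup (DistribSMul.toAddMonoidHom M r)
    (fun _ hx => L.smul_mem r hx)

instance NUSubmodule.instNUModuleQuot (L : NUSubmodule R M) : NUModule R L.Quot where
  smul r x := L.quotSmul r x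
  smul_zero r := (L.quotSmul r).map_zero
  smul_add r x y := (L.quotSmul r).map_add x y
  add_smul r s x := by
    obtain ⟨x, rfl⟩ := QuotientAddGroup.mk_surjective x
    exact congrArg (fun y : M => (QuotientAddGroup.mk y : L.Quot))
        (NUModule.add_smul r s x)
  mul_smul r s x := by
    obtain ⟨x, rfl⟩ := QuotientAddGroup.mk_surjective x
    exact congrArg (fun y : M => (QuotientAddGroup.mk y : L.Quot))
        (NUModule.mul_smul r s x)

@[simp] theorem NUSubmodule.quot_smul_mk (L : NUSubmodule R M) (r : R) (x : M) :
    r • (QuotientAddGroup.mk x : L.Quot) = QuotientAddGroup.mk (r • x) := rfl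

/-- A submodule `L` of `M`, intersected with a submodule `L'` and seen as a submodule of `L'`. -/
def NUSubmodule.subOf (L L' : NUSubmodule R M) : NUSubmodule R L'.Carrier where
  toAddSubgroup := L.toAddSubgroup.addSubgroupOf L'.toAddSubgroup
  smul_mem r _ hx := L.smul_mem r hx

/-- The direct sum of a family of modules. -/
instance instNUModuleDFinsupp {κ : Type*} (X : κ → Type*) [∀ k, AddCommGroup (X k)]
    [∀ k, NUModule R (X k)] : NUModule R (Π₀ k, X k) where
  smul r x := x.mapRange (fun _ y => r • y) (fun _ => smul_zero r)
  smul_zero r := by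
    ext k; exact smul_zero r
  smul_add r x y := by
    ext k; exact smul_add r (x k) (y k)
  add_smul r s x := by
    ext k; exact NUModule.add_smul r s (x k)
  mul_smul r s x := by
    ext k; exact NUModule.mul_smul r s (x k)

@[simp] theorem dfinsupp_smul_apply {κ : Type*} (X : κ → Type*) [∀ k, AddCommGroup (X k)]
    [∀ k, NUModule R (X k)] (r : R) (x : Π₀ k, X k) (k : κ) : (r • x) k = r • x k := rfl

variable (R M N) in
/-- Morphisms of left `R`-modules. -/
structure NUHom extends M →+ N where
  map_smul : ∀ (r : R) (x : M), toFun (r • x) = r • toFun x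

variable (R M N) in
/-- `M` and `N` are isomorphic as left `R`-modules. -/
def NUIso : Prop := ∃ φ : M ≃+ N, ∀ (r : R) (x : M), φ (r • x) = r • φ x

variable (R M N) in
/-- The trace of `M` in `N`: the sum of the images of all morphisms `M ⟶ N`. -/
def trace : NUSubmodule R N where
  toAddSubgroup := ⨆ φ : NUHom R M N, φ.toAddMonoidHom.range
  smul_mem r x hx := by
    refine AddSubgroup.iSup_induction (fun φ : NUHom R M N => φ.toAddMonoidHom.range)
      (C := fun x => r • x ∈ ⨆ φ : NUHom R M N, φ.toAddMonoidHom.range) hx ?_ ?_ ?_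
    · rintro φ _ ⟨y, rfl⟩
      exact AddSubgroup.mem_iSup_of_mem φ ⟨r • y, φ.map_smul r y⟩
    · rw [smul_zero]
      exact AddSubgroup.zero_mem _
    · intro x y hx hy
      rw [smul_add]
      exact AddSubgroup.add_mem _ hx hy

variable (R M) in
/-- `M` has a finite filtration `0 = L 0 ⊆ L 1 ⊆ ⋯ ⊆ L n = M` by submodules such that each
factor `L (k + 1) / L k` is isomorphic to some `X p` with `p ∈ S`. -/
def HasFiniteFiltration {κ : Type*} (X : κ → Type*) [∀ p, AddCommGroup (X p)]
    [∀ p, NUModule R (X p)] (S : Set κ) : Prop :=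
  ∃ (n : ℕ) (L : ℕ → NUSubmodule R M),
    (L 0).toAddSubgroup = ⊥ ∧ (L n).toAddSubgroup = ⊤ ∧
    ∀ k < n, (L k).toAddSubgroup ≤ (L (k + 1)).toAddSubgroup ∧
      ∃ p ∈ S, NUIso R ((L k).subOf (L (k + 1))).Quot (X p)

end Modules

/-! Algebras with enough idempotents. -/

section Algebras

/-- The left ideal `R a`, as a left `R`-module. -/
def leftIdeal {R : Type*} [NonUnitalRing R] (a : R) : NUSubmodule R R where
  toAddSubgroup := (AddMonoidHom.mulRight a).range
  smul_mem := by
    rintro r _ ⟨x, rfl⟩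
    exact ⟨r * x, mul_assoc r x a⟩

/-- The right ideal `a R`, as a subgroup. -/
def rightIdeal {R : Type*} [NonUnitalRing R] (a : R) : AddSubgroup R :=
  (AddMonoidHom.mulLeft a).range

/-- `a R b` as a `K`-submodule of the `K`-algebra `R`. -/
def corner (K : Type*) {R : Type*} [CommRing K] [NonUnitalRing R] [Module K R]
    [IsScalarTower K R R] [SMulCommClass K R R] (a b : R) : Submodule K R :=
  LinearMap.range ((LinearMap.mulRight K b).comp (LinearMap.mulLeft K a))

/-- A primitive idempotent. -/
def IsPrimitiveIdem {R : Type*} [NonUnitalRing R] (a : R) : Prop :=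
  a ≠ 0 ∧ a * a = a ∧
    ∀ x y : R, x * x = x → y * y = y → x * y = 0 → y * x = 0 → x + y = a → x = 0 ∨ y = 0

/-- `(R, e)` is an algebra with enough idempotents: the `e i` are orthogonal idempotents and
`R = ⨁ e i R = ⨁ R e i` (internal direct sums of subgroups: independent, with sum `R`). -/
structure HasEnoughIdempotents {R I : Type*} [NonUnitalRing R] (e : I → R) : Prop where
  idem : ∀ i, e i * e i = e i
  orth : ∀ i j, i ≠ j → e i * e j = 0
  right_indep : iSupIndep (fun i => rightIdeal (e i))
  right_sum : ⨆ i, rightIdeal (e i) = ⊤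
  left_indep : iSupIndep (fun i => (leftIdeal (e i)).toAddSubgroup)
  left_sum : ⨆ i, (leftIdeal (e i)).toAddSubgroup = ⊤

/-- `(R, e)` is a basic algebra with enough idempotents: it is Hom-finite, each `e i` is
primitive and the `R e i` are pairwise non-isomorphic. -/
structure IsBasic (K : Type*) {R I : Type*} [CommRing K] [NonUnitalRing R] [Module K R]
    [IsScalarTower K R R] [SMulCommClass K R R] (e : I → R) : Prop extends
    HasEnoughIdempotents e where
  homFinite : ∀ i j, IsFiniteLength K (corner K (e j) (e i))
  primitive : ∀ i, IsPrimitiveIdem (e i)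
  not_iso : ∀ i j, e i ≠ e j → ¬ NUIso R (leftIdeal (e i)).Carrier (leftIdeal (e j)).Carrier

end Algebras

/-! Partitions. -/

/-- A partition of `I` into non-empty blocks indexed by a linear order `ι`; the case of
interest is the interval `ι = [0, α)` of ordinals. -/
structure OrdPartition (I : Type*) (ι : Type*) [LinearOrder ι] where
  block : ι → Set I
  nonempty : ∀ i, (block i).Nonempty
  disjoint : ∀ i j, i ≠ j → Disjoint (block i) (block j)
  cover : ⋃ i, block i = Set.univ

/-- The joined partition: first the blocks of `A`, in their order, then those of `B`. -/
def OrdPartition.join {I J ι κ : Type*} [LinearOrder ι] [LinearOrder κ]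
    (A : OrdPartition I ι) (B : OrdPartition J κ) : OrdPartition (I ⊕ J) (ι ⊕ₗ κ) where
  block t := Sum.elim (fun i => Sum.inl '' A.block i) (fun j => Sum.inr '' B.block j) (ofLex t)
  nonempty t := by
    rcases h : ofLex t with i | j
    · simpa using A.nonempty i
    · simpa using B.nonempty j
  disjoint s t hst := by
    have h : ofLex s ≠ ofLex t := fun h => hst (ofLex.injective h)
    rcases hs : ofLex s with i | j <;> rcases ht : ofLex t with i' | j'
    · rw [hs, ht] at h
      exact Set.disjoint_image_of_injective Sum.inl_injective
        (A.disjoint i i' (fun hh => h (congrArg Sum.inl hh)))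
    · rw [Set.disjoint_left]; rintro _ ⟨x, -, rfl⟩ ⟨y, -, hy⟩; cases hy
    · rw [Set.disjoint_left]; rintro _ ⟨x, -, rfl⟩ ⟨y, -, hy⟩; cases hy
    · rw [hs, ht] at h
      exact Set.disjoint_image_of_injective Sum.inr_injective
        (B.disjoint j j' (fun hh => h (congrArg Sum.inr hh)))
  cover := by
    refine Set.eq_univ_of_forall fun x => Set.mem_iUnion.2 ?_
    rcases x with x | x
    · obtain ⟨i, hi⟩ := Set.mem_iUnion.1 (A.cover ▸ Set.mem_univ x : x ∈ ⋃ i, A.block i)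
      exact ⟨toLex (Sum.inl i), x, hi, rfl⟩
    · obtain ⟨i, hi⟩ := Set.mem_iUnion.1 (B.cover ▸ Set.mem_univ x : x ∈ ⋃ i, B.block i)
      exact ⟨toLex (Sum.inr i), x, hi, rfl⟩

/-! Standard modules. -/

section Standard

variable {R I ι : Type*} [NonUnitalRing R] [LinearOrder ι] (e : I → R) (A : OrdPartition I ι)

/-- The elements of the blocks of level `< i`. -/
def OrdPartition.below (i : ι) : Set I := {r | ∃ j < i, r ∈ A.block j}

/-- The direct sum of all `R e r`, with `r` in the blocks of level `< i`. -/
abbrev LowerProj (i : ι) : Type _ := Π₀ r : A.below i, (leftIdeal (e (r : I))).Carrier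

/-- The trace of the projectives of level `< i` in `R e t`. -/
def lowerTrace (i : ι) (t : I) : NUSubmodule R (leftIdeal (e t)).Carrier :=
  trace R (LowerProj e A i) (leftIdeal (e t)).Carrier

/-- The standard modules `Δ_t(i)`, for `p = (i, t)` with `t` in the `i`-th block. -/
abbrev StdModule (p : ι × I) : Type _ := (lowerTrace e A p.1 p.2).Quot

/-- `X` has a finite filtration by standard modules. -/
def IsGood (X : Type*) [AddCommGroup X] [NUModule R X] : Prop :=
  HasFiniteFiltration R X (StdModule e A) {p | p.2 ∈ A.block p.1}

/-- `X` has a finite filtration by standard modules of level `< i`. -/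
def IsGoodBelow (i : ι) (X : Type*) [AddCommGroup X] [NUModule R X] : Prop :=
  HasFiniteFiltration R X (StdModule e A) {p | p.1 < i ∧ p.2 ∈ A.block p.1}

/-- `(R, A)` is left standardly stratified (for `(R, e)` basic with enough idempotents). -/
def IsLeftStdStratified : Prop :=
  ∀ i, ∀ t ∈ A.block i, IsGoodBelow e A i (lowerTrace e A i t).Carrier

end Standard

/-! Bimodules and lower triangular matrix algebras. -/

section Bimodule

/-- The left `U`-submodule `M b` of a `U`-`T`-bimodule `M`, for `b : T`. -/
def colSubmodule (U M : Type*) {T : Type*} [NonUnitalRing U] [NonUnitalRing T] [AddCommGroup M]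
    [NUModule U M] [NUModule Tᵐᵒᵖ M] [SMulCommClass U Tᵐᵒᵖ M] (b : T) : NUSubmodule U M where
  toAddSubgroup := (DistribSMul.toAddMonoidHom M (MulOpposite.op b)).range
  smul_mem := by
    rintro u _ ⟨m, rfl⟩
    exact ⟨u • m, (smul_comm u (MulOpposite.op b) m).symm⟩

/-- `a M b` as a `K`-submodule of a `U`-`T`-bimodule `M`. -/
def bimoduleCorner (K M : Type*) {U T : Type*} [CommRing K] [NonUnitalRing U] [NonUnitalRing T]
    [AddCommGroup M] [Module K M] [NUModule U M] [NUModule Tᵐᵒᵖ M]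
    [SMulCommClass K U M] [SMulCommClass K Tᵐᵒᵖ M] (a : U) (b : T) : Submodule K M :=
  LinearMap.range
    ({ toFun := fun m => a • (MulOpposite.op b • m)
       map_add' := fun x y => by rw [smul_add, smul_add]
       map_smul' := fun k x => by
        rw [← smul_comm k, ← smul_comm k, RingHom.id_apply] } : M →ₗ[K] M)

/-- The matrices with rows `(t, 0)` and `(m, u)`. -/
@[ext] structure TriMat (T M U : Type*) where
  t : T
  m : M
  u : U

namespace TriMat

section

variable {U T M : Type*} [NonUnitalRing U] [NonUnitalRing T] [AddCommGroup M]

instance : Zero (TriMat T M U) := ⟨⟨0, 0, 0⟩⟩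
instance : Add (TriMat T M U) := ⟨fun x y => ⟨x.t + y.t, x.m + y.m, x.u + y.u⟩⟩
instance : Neg (TriMat T M U) := ⟨fun x => ⟨-x.t, -x.m, -x.u⟩⟩

@[simp] theorem zero_t : (0 : TriMat T M U).t = 0 := rfl
@[simp] theorem zero_m : (0 : TriMat T M U).m = 0 := rfl
@[simp] theorem zero_u : (0 : TriMat T M U).u = 0 := rfl
@[simp] theorem add_t (x y : TriMat T M U) : (x + y).t = x.t + y.t := rfl
@[simp] theorem add_m (x y : TriMat T M U) : (x + y).m = x.m + y.m := rfl
@[simp] theorem add_u (x y : TriMat T M U) : (x + y).u = x.u + y.u := rfl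
@[simp] theorem neg_t (x : TriMat T M U) : (-x).t = -x.t := rfl
@[simp] theorem neg_m (x : TriMat T M U) : (-x).m = -x.m := rfl
@[simp] theorem neg_u (x : TriMat T M U) : (-x).u = -x.u := rfl

instance instAddCommGroup : AddCommGroup (TriMat T M U) where
  add_assoc x y z := by ext <;> simp [add_assoc]
  zero_add x := by ext <;> simp
  add_zero x := by ext <;> simp
  add_comm x y := by ext <;> simp [add_comm]
  neg_add_cancel x := by ext <;> simp
  nsmul := nsmulRec
  zsmul := zsmulRec

variable {K : Type*} [CommRing K] [Module K U] [Module K T] [Module K M]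

instance : SMul K (TriMat T M U) := ⟨fun k x => ⟨k • x.t, k • x.m, k • x.u⟩⟩

@[simp] theorem smul_t (k : K) (x : TriMat T M U) : (k • x).t = k • x.t := rfl
@[simp] theorem smul_m (k : K) (x : TriMat T M U) : (k • x).m = k • x.m := rfl
@[simp] theorem smul_u (k : K) (x : TriMat T M U) : (k • x).u = k • x.u := rfl

instance instModule : Module K (TriMat T M U) where
  one_smul x := by ext <;> simp
  mul_smul k l x := by ext <;> simp [mul_smul]
  smul_zero k := by ext <;> simp
  smul_add k x y := by ext <;> simp
  add_smul k l x := by ext <;> simp [add_smul]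
  zero_smul x := by ext <;> simp

end

theorem nu_zero_smul {R N : Type*} [NonUnitalRing R] [AddCommGroup N] [NUModule R N] (x : N) :
    (0 : R) • x = 0 := by
  have h := NUModule.add_smul (0 : R) 0 x
  rw [add_zero] at h
  exact left_eq_add.1 h

section

variable {U T M : Type*} [NonUnitalRing U] [NonUnitalRing T] [AddCommGroup M]
  [NUModule U M] [NUModule Tᵐᵒᵖ M]

instance : Mul (TriMat T M U) :=
  ⟨fun x y => ⟨x.t * y.t, MulOpposite.op y.t • x.m + x.u • y.m, x.u * y.u⟩⟩

@[simp] theorem mul_t (x y : TriMat T M U) : (x * y).t = x.t * y.t := rfl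
@[simp] theorem mul_m (x y : TriMat T M U) :
    (x * y).m = MulOpposite.op y.t • x.m + x.u • y.m := rfl
@[simp] theorem mul_u (x y : TriMat T M U) : (x * y).u = x.u * y.u := rfl

instance instNonUnitalRing [SMulCommClass U Tᵐᵒᵖ M] : NonUnitalRing (TriMat T M U) where
  __ := instAddCommGroup
  left_distrib x y z := by
    ext
    · simp [mul_add]
    · simp only [mul_m, add_t, add_m, MulOpposite.op_add, NUModule.add_smul, smul_add]; abel
    · simp [mul_add]
  right_distrib x y z := by
    ext
    · simp [add_mul]
    · simp only [mul_m, add_u, add_m, NUModule.add_smul, smul_add]; abel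
    · simp [add_mul]
  zero_mul x := by ext <;> simp [nu_zero_smul]
  mul_zero x := by ext <;> simp [nu_zero_smul]
  mul_assoc x y z := by
    ext
    · simp [mul_assoc]
    · simp only [mul_m, mul_t, mul_u, MulOpposite.op_mul, NUModule.mul_smul, smul_add,
        smul_comm x.u (MulOpposite.op z.t), add_assoc]
    · simp [mul_assoc]

variable {K : Type*} [CommRing K] [Module K U] [Module K T] [Module K M]
variable [SMulCommClass U Tᵐᵒᵖ M]

instance instIsScalarTower [IsScalarTower K U U] [IsScalarTower K T T]
    [IsScalarTower K U M] [SMulCommClass K Tᵐᵒᵖ M] :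
    IsScalarTower K (TriMat T M U) (TriMat T M U) where
  smul_assoc k x y := by
    simp only [smul_eq_mul]
    ext
    · simp [smul_mul_assoc]
    · simp only [mul_m, smul_m, smul_u, smul_add, smul_assoc, smul_comm k]
    · simp [smul_mul_assoc]

instance instSMulCommClass [SMulCommClass K U U] [SMulCommClass K T T]
    [SMulCommClass K U M] [IsScalarTower K Tᵐᵒᵖ M] :
    SMulCommClass K (TriMat T M U) (TriMat T M U) where
  smul_comm k x y := by
    simp only [smul_eq_mul]
    ext
    · simp [mul_smul_comm]
    · simp only [mul_m, smul_m, smul_t, smul_add, MulOpposite.op_smul, smul_assoc, smul_comm k]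
    · simp [mul_smul_comm]

end

/-- The family of idempotents of the triangular matrix algebra, indexed by the disjoint union:
`e i` in the lower right corner and `f j` in the upper left corner. -/
def idem (M : Type*) {U T I J : Type*} [Zero U] [Zero T] [Zero M] (e : I → U) (f : J → T) :
    I ⊕ J → TriMat T M U :=
  Sum.elim (fun i => ⟨0, 0, e i⟩) (fun j => ⟨f j, 0, 0⟩)

end TriMat

end Bimodule

end EnoughIdem

universe w₁ w₂

open EnoughIdem

/-!
Write `Λ` for the triangular matrix algebra. A `Λ`-module restricts to `U` and to `T` along the two
diagonal corners, and truncation to a corner (`N ↦ U N`, `N ↦ T N`) is exact; conversely `U`- and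
`T`-modules inflate to `Λ`-modules along the two projections `Λ ⟶ U` and `Λ ⟶ T`.

Since the trace of the `R e_r` in `R e_t` is the sum of the `R e_r R e_t`
(`mem_lowerTrace_iff`), the traces over `Λ` can be read off. For `t` in a block of `A` the trace is
that of `U`. For `t` in a block of `B` all projectives of `U` come earlier, so the trace `τ`
contains `U M f_t = M f_t`, and there is an exact sequence `0 ⟶ M f_t ⟶ τ ⟶ τ_T ⟶ 0` with
`τ_T` the trace over `T`. In both cases the standard modules of `Λ` are inflated from those of `U`
and `T` (`TriMat.exists_stdModule_equiv_inl`, `TriMat.exists_stdModule_equiv_inr`).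

So filtrations of `M f_t` and of `τ_T` can be inflated and concatenated to one of `τ`
(`HasFiniteFiltration.extension`). Conversely truncation of a filtration of `τ` to the corner `U`
gives one of `M f_t`, and truncation to the corner `T` gives one of `τ_T`: each factor is either
inflated from that corner, and is kept, or from the other one, and disappears
(`HasFiniteFiltration.truncate`). That `Λ` is basic is checked entry by entry.
-/

namespace EnoughIdem

/-! ### Filtrations and change of rings -/

section Filtration

variable {R N : Type*} [NonUnitalRing R] [AddCommGroup N] [NUModule R N]

theorem NUSubmodule.ext_toAddSubgroup {L L' : NUSubmodule R N}
    (h : L.toAddSubgroup = L'.toAddSubgroup) : L = L' := by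
  cases L; cases L'; cases h; rfl

/-- `L ⊆ L'` and `L' / L ≅ X`, the isomorphism being given as a surjective morphism `L' ⟶ X`
with kernel `L`. -/
def IsFactor (L L' : NUSubmodule R N) (X : Type*) [AddCommGroup X] [NUModule R X] : Prop :=
  L.toAddSubgroup ≤ L'.toAddSubgroup ∧
    ∃ φ : L'.Carrier →+ X, Function.Surjective φ ∧ (∀ (r : R) x, φ (r • x) = r • φ x) ∧
      ∀ x, φ x = 0 ↔ (x : N) ∈ L.toAddSubgroup

theorem isFactor_iff {L L' : NUSubmodule R N} {X : Type*} [AddCommGroup X] [NUModule R X] :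
    IsFactor L L' X ↔
      L.toAddSubgroup ≤ L'.toAddSubgroup ∧ NUIso R (L.subOf L').Quot X := by
  refine and_congr_right fun _ => ⟨?_, ?_⟩
  · rintro ⟨φ, hs, hl, hk⟩
    let ψ : (L.subOf L').Quot →+ X :=
      QuotientAddGroup.lift (L.subOf L').toAddSubgroup φ fun x hx => (hk x).2 hx
    have hψ : Function.Bijective ψ := by
      refine ⟨(injective_iff_map_eq_zero ψ).2 fun y hy => ?_, fun y => ?_⟩
      · obtain ⟨x, rfl⟩ := QuotientAddGroup.mk_surjective y
        exact (QuotientAddGroup.eq_zero_iff x).2 ((hk x).1 hy)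
      · obtain ⟨x, rfl⟩ := hs y
        exact ⟨QuotientAddGroup.mk x, rfl⟩
    refine ⟨AddEquiv.ofBijective ψ hψ, fun r y => ?_⟩
    obtain ⟨x, rfl⟩ := QuotientAddGroup.mk_surjective y
    exact hl r x
  · rintro ⟨ψ, hψ⟩
    refine ⟨ψ.toAddMonoidHom.comp (QuotientAddGroup.mk' (L.subOf L').toAddSubgroup),
      ψ.surjective.comp (QuotientAddGroup.mk'_surjective _), fun r x => ?_, fun x => ?_⟩
    · exact hψ r (QuotientAddGroup.mk x)
    · exact (map_eq_zero_iff ψ ψ.injective).trans (QuotientAddGroup.eq_zero_iff x)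

/-- One step `L ⊆ L'` of a filtration with factors among the `X p`, `p ∈ S`. -/
def FiltStep {κ : Type*} (X : κ → Type*) [∀ p, AddCommGroup (X p)] [∀ p, NUModule R (X p)]
    (S : Set κ) (L L' : NUSubmodule R N) : Prop :=
  ∃ p ∈ S, IsFactor L L' (X p)

/-- A finite filtration is a chain of steps from `0` to the whole module. -/
theorem hasFiniteFiltration_iff {κ : Type*} {X : κ → Type*} [∀ p, AddCommGroup (X p)]
    [∀ p, NUModule R (X p)] {S : Set κ} :
    HasFiniteFiltration R N X S ↔ ∃ L₀ L₁ : NUSubmodule R N, L₀.toAddSubgroup = ⊥ ∧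
      L₁.toAddSubgroup = ⊤ ∧ Relation.ReflTransGen (FiltStep X S) L₀ L₁ := by
  constructor
  · rintro ⟨n, L, h0, hn, h⟩
    refine ⟨L 0, L n, h0, hn, ?_⟩
    clear hn
    induction n with
    | zero => exact .refl
    | succ n ih =>
      obtain ⟨hle, p, hp, hiso⟩ := h n n.lt_succ_self
      exact (ih fun k hk => h k (hk.trans n.lt_succ_self)).tail ⟨p, hp, isFactor_iff.2 ⟨hle, hiso⟩⟩
  · rintro ⟨L₀, L₁, h0, h1, hc⟩
    suffices h : ∃ (n : ℕ) (L : ℕ → NUSubmodule R N), L 0 = L₀ ∧ L n = L₁ ∧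
        ∀ k < n, FiltStep X S (L k) (L (k + 1)) by
      obtain ⟨n, L, rfl, rfl, h⟩ := h
      refine ⟨n, L, h0, h1, fun k hk => ?_⟩
      obtain ⟨p, hp, hf⟩ := h k hk
      exact ⟨(isFactor_iff.1 hf).1, p, hp, (isFactor_iff.1 hf).2⟩
    clear h1
    induction hc with
    | refl => exact ⟨0, fun _ => L₀, rfl, rfl, fun k hk => absurd hk k.not_lt_zero⟩
    | @tail L₁ L₂ _ hs ih =>
      obtain ⟨n, L, hL0, hLn, h⟩ := ih
      refine ⟨n + 1, fun k => if k ≤ n then L k else L₂, by simp [hL0], by simp, fun k hk => ?_⟩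
      rcases (Nat.lt_succ_iff.1 hk).lt_or_eq with hk' | rfl
      · simpa [hk'.le, Nat.succ_le_iff.2 hk'] using h k hk'
      · simpa [hLn] using hs

end Filtration

section ChangeOfRings

variable {R R' N N' : Type*} [NonUnitalRing R] [NonUnitalRing R']
  [AddCommGroup N] [NUModule R N] [AddCommGroup N'] [NUModule R' N']

/-- The preimage of a submodule under a map that is semilinear along `σ : R' → R`. -/
def NUSubmodule.semicomap (ι : N' →+ N) (σ : R' → R) (h : ∀ r x, ι (r • x) = σ r • ι x)
    (L : NUSubmodule R N) : NUSubmodule R' N' where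
  toAddSubgroup := L.toAddSubgroup.comap ι
  smul_mem r x hx := by
    change ι (r • x) ∈ L.toAddSubgroup
    rw [h]
    exact L.smul_mem _ hx

/-- The image of a submodule under a map `ι` with `ι (ρ r • x) = r • ι x`, for `ρ : R → R'`. -/
def NUSubmodule.semimap (ι : N' →+ N) (ρ : R → R') (h : ∀ r x, ι (ρ r • x) = r • ι x)
    (L : NUSubmodule R' N') : NUSubmodule R N where
  toAddSubgroup := L.toAddSubgroup.map ι
  smul_mem := by
    rintro r _ ⟨x, hx, rfl⟩
    exact ⟨ρ r • x, L.smul_mem _ hx, h r x⟩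

variable {X X' : Type*} [AddCommGroup X] [NUModule R X] [AddCommGroup X'] [NUModule R' X']

/-- The image of a factor under an injective map. -/
theorem IsFactor.semimap {ι : N' →+ N} {ρ : R → R'} {h : ∀ r x, ι (ρ r • x) = r • ι x}
    (hι : Function.Injective ι) {L L' : NUSubmodule R' N'} (hL : IsFactor L L' X')
    (ψ : X ≃+ X') (hψ : ∀ (r : R) x, ψ (r • x) = ρ r • ψ x) :
    IsFactor (L.semimap ι ρ h) (L'.semimap ι ρ h) X := by
  obtain ⟨hle, φ, hs, hl, hk⟩ := hL
  let E : L'.Carrier ≃+ (L'.semimap ι ρ h).Carrier :=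
    L'.toAddSubgroup.equivMapOfInjective ι hι
  have hE : ∀ x, (E x : N) = ι x := fun x => rfl
  have hEl : ∀ (r : R) x, E.symm (r • x) = ρ r • E.symm x := fun r x => by
    rw [E.symm_apply_eq]
    refine Subtype.ext ?_
    rw [hE, NUSubmodule.coe_smul, NUSubmodule.coe_smul, h, ← hE, E.apply_symm_apply]
  refine ⟨AddSubgroup.map_mono hle,
    (ψ.symm.toAddMonoidHom.comp φ).comp E.symm.toAddMonoidHom,
    (ψ.symm.surjective.comp hs).comp E.symm.surjective, fun r x => ?_, fun x => ?_⟩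
  · change ψ.symm (φ (E.symm (r • x))) = r • ψ.symm (φ (E.symm x))
    rw [ψ.symm_apply_eq, hEl, hl, hψ, ψ.apply_symm_apply]
  · obtain ⟨x, rfl⟩ := E.surjective x
    change ψ.symm (φ (E.symm (E x))) = 0 ↔ (E x : N) ∈ L.toAddSubgroup.map ι
    rw [map_eq_zero_iff _ ψ.symm.injective, E.symm_apply_apply, hk, hE,
      AddSubgroup.mem_map_iff_mem hι]

/-- The preimage of a factor under a surjective map. -/
theorem IsFactor.semicomap_of_surjective {π : N' →+ N} {σ : R' → R}
    {h : ∀ r x, π (r • x) = σ r • π x}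
    (hπ : Function.Surjective π) {L L' : NUSubmodule R N} (hL : IsFactor L L' X)
    (ψ : X' ≃+ X) (hψ : ∀ (r : R') x, ψ (r • x) = σ r • ψ x) :
    IsFactor (L.semicomap π σ h) (L'.semicomap π σ h) X' := by
  obtain ⟨hle, φ, hs, hl, hk⟩ := hL
  let p : (L'.semicomap π σ h).Carrier →+ L'.Carrier :=
    (π.comp (L'.semicomap π σ h).toAddSubgroup.subtype).codRestrict L'.toAddSubgroup
      fun x => x.2
  refine ⟨AddSubgroup.comap_mono hle, (ψ.symm.toAddMonoidHom.comp φ).comp p,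
    (ψ.symm.surjective.comp hs).comp fun y => ?_, fun r x => ?_, fun x => ?_⟩
  · obtain ⟨x, hx⟩ := hπ y
    exact ⟨⟨x, show π x ∈ L'.toAddSubgroup from hx ▸ y.2⟩, Subtype.ext hx⟩
  · change ψ.symm (φ (p (r • x))) = r • ψ.symm (φ (p x))
    have hp : p (r • x) = σ r • p x := Subtype.ext (h r x)
    rw [ψ.symm_apply_eq, hp, hl, hψ, ψ.apply_symm_apply]
  · change ψ.symm (φ (p x)) = 0 ↔ _
    rw [map_eq_zero_iff _ ψ.symm.injective, hk]
    rfl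

/-- `N` has local units: each element is fixed by some element of the ring. -/
def HasLocalUnits (R N : Type*) [NonUnitalRing R] [AddCommGroup N] [NUModule R N] : Prop :=
  ∀ x : N, ∃ r : R, r • x = x

theorem HasLocalUnits.carrier (hN : HasLocalUnits R N) (L : NUSubmodule R N) :
    HasLocalUnits R L.Carrier := fun x => by
  obtain ⟨r, hr⟩ := hN x
  exact ⟨r, Subtype.ext hr⟩

theorem HasLocalUnits.quot (hN : HasLocalUnits R N) (L : NUSubmodule R N) :
    HasLocalUnits R L.Quot := fun y => by
  obtain ⟨x, rfl⟩ := QuotientAddGroup.mk_surjective y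
  obtain ⟨r, hr⟩ := hN x
  exact ⟨r, congrArg QuotientAddGroup.mk hr⟩

/-- The truncation of a factor on which `σ R'` acts as `R'` does on `X'`. -/
theorem IsFactor.semicomap_of_equiv {ι : N' →+ N} {σ : R' → R}
    {h : ∀ r x, ι (r • x) = σ r • ι x} (hr : ∀ r x, σ r • x ∈ ι.range)
    {L L' : NUSubmodule R N} (hL : IsFactor L L' X) (hX' : HasLocalUnits R' X')
    (ψ : X ≃+ X') (hψ : ∀ r x, ψ (σ r • x) = r • ψ x) :
    IsFactor (L.semicomap ι σ h) (L'.semicomap ι σ h) X' := by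
  obtain ⟨hle, φ, hs, hl, hk⟩ := hL
  let p : (L'.semicomap ι σ h).Carrier →+ L'.Carrier :=
    (ι.comp (L'.semicomap ι σ h).toAddSubgroup.subtype).codRestrict L'.toAddSubgroup
      fun x => x.2
  refine ⟨AddSubgroup.comap_mono hle, (ψ.toAddMonoidHom.comp φ).comp p, fun y => ?_,
    fun r x => ?_, fun x => ?_⟩
  · -- A preimage of `y = r • y` in `L'` is moved into the range of `ι` by `σ r`.
    obtain ⟨r, hry⟩ := hX' y
    obtain ⟨x, hx⟩ := hs (ψ.symm y)
    obtain ⟨z, hz⟩ := hr r (x : N)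
    have hzL : ι z ∈ L'.toAddSubgroup := hz ▸ L'.smul_mem _ x.2
    refine ⟨⟨z, hzL⟩, ?_⟩
    have hp : p ⟨z, hzL⟩ = σ r • x := Subtype.ext hz
    change ψ (φ (p ⟨z, hzL⟩)) = y
    rw [hp, hl, hx, hψ, ψ.apply_symm_apply, hry]
  · change ψ (φ (p (r • x))) = r • ψ (φ (p x))
    have hp : p (r • x) = σ r • p x := Subtype.ext (h r x)
    rw [hp, hl, hψ]
  · change ψ (φ (p x)) = 0 ↔ _
    rw [map_eq_zero_iff _ ψ.injective, hk]
    rfl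

/-- The truncation of a factor that is killed by `σ R'` is zero. -/
theorem IsFactor.semicomap_eq {ι : N' →+ N} {σ : R' → R}
    {h : ∀ r x, ι (r • x) = σ r • ι x} (hN' : HasLocalUnits R' N')
    {L L' : NUSubmodule R N} (hL : IsFactor L L' X) (hX : ∀ (r : R') (x : X), σ r • x = 0) :
    L.semicomap ι σ h = L'.semicomap ι σ h := by
  obtain ⟨hle, φ, hs, hl, hk⟩ := hL
  refine NUSubmodule.ext_toAddSubgroup (le_antisymm (AddSubgroup.comap_mono hle) fun x hx => ?_)
  obtain ⟨r, hrx⟩ := hN' x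
  have hx' : ι x ∈ L'.toAddSubgroup := hx
  have h0 : φ (σ r • ⟨ι x, hx'⟩) = 0 := by rw [hl, hX]
  have h1 := (hk _).1 h0
  rw [NUSubmodule.coe_smul, ← h, hrx] at h1
  exact h1

variable {κ κ' : Type*} {Y : κ → Type*} [∀ p, AddCommGroup (Y p)] [∀ p, NUModule R (Y p)]
  {Y' : κ' → Type*} [∀ p, AddCommGroup (Y' p)] [∀ p, NUModule R' (Y' p)]
  {S : Set κ} {S' : Set κ'}

/-- Let `N'` be embedded into `N` along a map of rings `σ : R' → R`, with image containing all
`σ r • x`; thus `N' = (σ R') N`. This truncation is exact, so it sends a filtration of `N` to one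
of `N'`, if the truncation of each factor either is an admissible factor or vanishes. -/
theorem HasFiniteFiltration.truncate (hN : HasFiniteFiltration R N Y S) (ι : N' →+ N)
    (hι : Function.Injective ι) (σ : R' → R) (h : ∀ r x, ι (r • x) = σ r • ι x)
    (hr : ∀ r x, σ r • x ∈ ι.range) (hN' : HasLocalUnits R' N')
    (hY' : ∀ p ∈ S', HasLocalUnits R' (Y' p))
    (hY : ∀ p ∈ S, (∃ p' ∈ S', ∃ ψ : Y p ≃+ Y' p', ∀ r x, ψ (σ r • x) = r • ψ x) ∨
      ∀ (r : R') (x : Y p), σ r • x = 0) :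
    HasFiniteFiltration R' N' Y' S' := by
  obtain ⟨L₀, L₁, h0, h1, hc⟩ := hasFiniteFiltration_iff.1 hN
  refine hasFiniteFiltration_iff.2 ⟨L₀.semicomap ι σ h, L₁.semicomap ι σ h, ?_, ?_,
    Relation.ReflTransGen.lift' (NUSubmodule.semicomap ι σ h) ?_ _ _ hc⟩
  · change L₀.toAddSubgroup.comap ι = ⊥
    rw [h0]
    exact (AddMonoidHom.ker_eq_bot_iff ι).2 hι
  · change L₁.toAddSubgroup.comap ι = ⊤
    rw [h1, AddSubgroup.comap_top]
  · rintro L L' ⟨p, hp, hL⟩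
    rcases hY p hp with ⟨p', hp', ψ, hψ⟩ | hz
    · exact .single ⟨p', hp', hL.semicomap_of_equiv hr (hY' p' hp') ψ hψ⟩
    · rw [Function.onFun, hL.semicomap_eq hN' hz]

/-- The image of a chain of steps under an injective map. -/
theorem FiltStep.chain_semimap {ι : N' →+ N} {ρ : R → R'} (h : ∀ r x, ι (ρ r • x) = r • ι x)
    (hι : Function.Injective ι)
    (hY : ∀ p' ∈ S', ∃ p ∈ S, ∃ ψ : Y p ≃+ Y' p', ∀ (r : R) x, ψ (r • x) = ρ r • ψ x)
    {L L' : NUSubmodule R' N'} (hL : Relation.ReflTransGen (FiltStep Y' S') L L') :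
    Relation.ReflTransGen (FiltStep Y S) (L.semimap ι ρ h) (L'.semimap ι ρ h) := by
  refine Relation.ReflTransGen.lift (NUSubmodule.semimap ι ρ h) ?_ _ _ hL
  rintro L L' ⟨p', hp', hL⟩
  obtain ⟨p, hp, ψ, hψ⟩ := hY p' hp'
  exact ⟨p, hp, hL.semimap hι ψ hψ⟩

/-- The preimage of a chain of steps under a surjective map. -/
theorem FiltStep.chain_semicomap {π : N →+ N'} {ρ : R → R'} (h : ∀ r x, π (r • x) = ρ r • π x)
    (hπ : Function.Surjective π)
    (hY : ∀ p' ∈ S', ∃ p ∈ S, ∃ ψ : Y p ≃+ Y' p', ∀ (r : R) x, ψ (r • x) = ρ r • ψ x)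
    {L L' : NUSubmodule R' N'} (hL : Relation.ReflTransGen (FiltStep Y' S') L L') :
    Relation.ReflTransGen (FiltStep Y S) (L.semicomap π ρ h) (L'.semicomap π ρ h) := by
  refine Relation.ReflTransGen.lift (NUSubmodule.semicomap π ρ h) ?_ _ _ hL
  rintro L L' ⟨p', hp', hL⟩
  obtain ⟨p, hp, ψ, hψ⟩ := hY p' hp'
  exact ⟨p, hp, hL.semicomap_of_surjective hπ ψ hψ⟩

/-- A filtration is carried over along a bijection `N' ≃ N`. -/
theorem HasFiniteFiltration.inflate (hN' : HasFiniteFiltration R' N' Y' S') (ι : N' →+ N)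
    (hι : Function.Bijective ι) (ρ : R → R') (h : ∀ r x, ι (ρ r • x) = r • ι x)
    (hY : ∀ p' ∈ S', ∃ p ∈ S, ∃ ψ : Y p ≃+ Y' p', ∀ (r : R) x, ψ (r • x) = ρ r • ψ x) :
    HasFiniteFiltration R N Y S := by
  obtain ⟨L₀, L₁, h0, h1, hc⟩ := hasFiniteFiltration_iff.1 hN'
  refine hasFiniteFiltration_iff.2 ⟨_, _, ?_, ?_, FiltStep.chain_semimap h hι.1 hY hc⟩
  · change L₀.toAddSubgroup.map ι = ⊥
    rw [h0, AddSubgroup.map_bot]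
  · change L₁.toAddSubgroup.map ι = ⊤
    rw [h1, ← AddMonoidHom.range_eq_map, AddMonoidHom.range_eq_top.2 hι.2]

/-- An extension `0 ⟶ N' ⟶ N ⟶ N'' ⟶ 0` of filtered modules is filtered; here `N'` and `N''` are
modules over other rings, inflated to `R`-modules along `ρ` and `ρ'`. -/
theorem HasFiniteFiltration.extension {R'' N'' κ'' : Type*} [NonUnitalRing R'']
    [AddCommGroup N''] [NUModule R'' N''] {Y'' : κ'' → Type*} [∀ p, AddCommGroup (Y'' p)]
    [∀ p, NUModule R'' (Y'' p)] {S'' : Set κ''}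
    (hN' : HasFiniteFiltration R' N' Y' S') (hN'' : HasFiniteFiltration R'' N'' Y'' S'')
    (ι : N' →+ N) (hι : Function.Injective ι) (ρ : R → R') (h : ∀ r x, ι (ρ r • x) = r • ι x)
    (π : N →+ N'') (hπ : Function.Surjective π) (ρ' : R → R'')
    (h' : ∀ r x, π (r • x) = ρ' r • π x) (hex : ι.range = π.ker)
    (hY' : ∀ p' ∈ S', ∃ p ∈ S, ∃ ψ : Y p ≃+ Y' p', ∀ (r : R) x, ψ (r • x) = ρ r • ψ x)
    (hY'' : ∀ p' ∈ S'', ∃ p ∈ S, ∃ ψ : Y p ≃+ Y'' p', ∀ (r : R) x, ψ (r • x) = ρ' r • ψ x) :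
    HasFiniteFiltration R N Y S := by
  obtain ⟨L₀, L₁, h0, h1, hc⟩ := hasFiniteFiltration_iff.1 hN'
  obtain ⟨L₂, L₃, h2, h3, hc'⟩ := hasFiniteFiltration_iff.1 hN''
  have hmid : L₁.semimap ι ρ h = L₂.semicomap π ρ' h' := by
    refine NUSubmodule.ext_toAddSubgroup ?_
    change L₁.toAddSubgroup.map ι = L₂.toAddSubgroup.comap π
    rw [h1, h2, ← AddMonoidHom.range_eq_map, hex]
    rfl
  have hchain := FiltStep.chain_semimap h hι hY' hc
  rw [hmid] at hchain
  refine hasFiniteFiltration_iff.2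
    ⟨_, _, ?_, ?_, hchain.trans (FiltStep.chain_semicomap h' hπ hY'' hc')⟩
  · change L₀.toAddSubgroup.map ι = ⊥
    rw [h0, AddSubgroup.map_bot]
  · change L₃.toAddSubgroup.comap π = ⊤
    rw [h3, AddSubgroup.comap_top]

/-- A surjection that carries `L` to `L'` and pulls `L'` back to `L` induces an isomorphism of
the quotients. -/
theorem exists_quot_equiv (π : N →+ N') (hπ : Function.Surjective π) (ρ : R → R')
    (h : ∀ r x, π (r • x) = ρ r • π x) (L : NUSubmodule R N) (L' : NUSubmodule R' N')
    (hL : ∀ x, x ∈ L.toAddSubgroup ↔ π x ∈ L'.toAddSubgroup) :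
    ∃ ψ : L.Quot ≃+ L'.Quot, ∀ (r : R) x, ψ (r • x) = ρ r • ψ x := by
  let ψ : L.Quot →+ L'.Quot :=
    QuotientAddGroup.map L.toAddSubgroup L'.toAddSubgroup π fun x hx => (hL x).1 hx
  have hψ : Function.Bijective ψ := by
    refine ⟨(injective_iff_map_eq_zero ψ).2 fun y hy => ?_, fun y => ?_⟩
    · obtain ⟨x, rfl⟩ := QuotientAddGroup.mk_surjective y
      exact (QuotientAddGroup.eq_zero_iff x).2
        ((hL x).2 ((QuotientAddGroup.eq_zero_iff (π x)).1 hy))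
    · obtain ⟨y, rfl⟩ := QuotientAddGroup.mk_surjective y
      obtain ⟨x, rfl⟩ := hπ y
      exact ⟨QuotientAddGroup.mk x, rfl⟩
  refine ⟨AddEquiv.ofBijective ψ hψ, fun r y => ?_⟩
  obtain ⟨x, rfl⟩ := QuotientAddGroup.mk_surjective y
  exact congrArg (QuotientAddGroup.mk : N' → L'.Quot) (h r x)

end ChangeOfRings

/-! ### Local units, isomorphisms and traces -/

section EnoughIdempotents

variable {R I : Type*} [NonUnitalRing R] {e : I → R}

theorem mem_leftIdeal {a x : R} : x ∈ (leftIdeal a).toAddSubgroup ↔ ∃ y, y * a = x := Iff.rfl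

theorem mul_mem_leftIdeal (x a : R) : x * a ∈ (leftIdeal a).toAddSubgroup := ⟨x, rfl⟩

theorem mem_rightIdeal {a x : R} : x ∈ rightIdeal a ↔ ∃ y, a * y = x := Iff.rfl

theorem mul_eq_of_mem_leftIdeal {a x : R} (ha : a * a = a)
    (hx : x ∈ (leftIdeal a).toAddSubgroup) : x * a = x := by
  obtain ⟨y, rfl⟩ := mem_leftIdeal.1 hx
  rw [mul_assoc, ha]

/-- Orthogonal idempotents whose left and right ideals span the ring: the independence of these
ideals is automatic. -/
theorem HasEnoughIdempotents.of_sum (idem : ∀ i, e i * e i = e i)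
    (orth : ∀ i j, i ≠ j → e i * e j = 0) (hr : ⨆ i, rightIdeal (e i) = ⊤)
    (hl : ⨆ i, (leftIdeal (e i)).toAddSubgroup = ⊤) : HasEnoughIdempotents e where
  idem := idem
  orth := orth
  right_sum := hr
  left_sum := hl
  right_indep i := by
    rw [AddSubgroup.disjoint_def]
    intro x hx hx'
    have h1 : e i * x = x := by
      obtain ⟨y, rfl⟩ := mem_rightIdeal.1 hx
      rw [← mul_assoc, idem]
    have h2 : ⨆ j, ⨆ (_ : j ≠ i), rightIdeal (e j) ≤ (AddMonoidHom.mulLeft (e i)).ker := by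
      refine iSup₂_le fun j hj y hy => ?_
      obtain ⟨y, rfl⟩ := mem_rightIdeal.1 hy
      change e i * (e j * y) = 0
      rw [← mul_assoc, orth i j hj.symm, zero_mul]
    exact h1.symm.trans (h2 hx')
  left_indep i := by
    rw [AddSubgroup.disjoint_def]
    intro x hx hx'
    have h1 : x * e i = x := mul_eq_of_mem_leftIdeal (idem i) hx
    have h2 : ⨆ j, ⨆ (_ : j ≠ i), (leftIdeal (e j)).toAddSubgroup ≤
        (AddMonoidHom.mulRight (e i)).ker := by
      refine iSup₂_le fun j hj y hy => ?_
      obtain ⟨y, rfl⟩ := mem_leftIdeal.1 hy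
      change y * e j * e i = 0
      rw [mul_assoc, orth j i hj, mul_zero]
    exact h1.symm.trans (h2 hx')

variable {N : Type*} [AddCommGroup N] [NUModule R N]

theorem sum_nu_smul (s : Finset I) (x : N) : (∑ i ∈ s, e i) • x = ∑ i ∈ s, e i • x := by
  classical
  induction s using Finset.induction_on with
  | empty => simp [TriMat.nu_zero_smul]
  | insert i s hi ih => rw [Finset.sum_insert hi, Finset.sum_insert hi, NUModule.add_smul, ih]

/-- The finite partial sums of the idempotents are eventually a left unit for each element. -/
theorem HasEnoughIdempotents.eventually_sum_mul (he : HasEnoughIdempotents e) (x : R) :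
    ∀ᶠ s : Finset I in Filter.atTop, (∑ i ∈ s, e i) * x = x := by
  classical
  have hx : x ∈ ⨆ i, rightIdeal (e i) := he.right_sum ▸ AddSubgroup.mem_top x
  refine AddSubgroup.iSup_induction (fun i => rightIdeal (e i))
    (C := fun x => ∀ᶠ s : Finset I in Filter.atTop, (∑ i ∈ s, e i) * x = x) hx ?_ ?_ ?_
  · intro i x hx
    obtain ⟨y, rfl⟩ := mem_rightIdeal.1 hx
    filter_upwards [Filter.eventually_ge_atTop {i}] with s hs
    rw [← mul_assoc, Finset.sum_mul,
      Finset.sum_eq_single_of_mem i (hs (Finset.mem_singleton_self i)) fun j _ hj => he.orth j i hj,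
      he.idem]
  · simp
  · intro x y hx hy
    filter_upwards [hx, hy] with s h1 h2
    rw [mul_add, h1, h2]

theorem HasEnoughIdempotents.eventually_sum_smul (he : HasEnoughIdempotents e)
    (hN : IsUnitary R N) (x : N) : ∀ᶠ s : Finset I in Filter.atTop, (∑ i ∈ s, e i) • x = x := by
  have hx : x ∈ AddSubgroup.closure {x : N | ∃ (r : R) (m : N), x = r • m} :=
    hN ▸ AddSubgroup.mem_top x
  induction hx using AddSubgroup.closure_induction with
  | mem x hx =>
    obtain ⟨r, m, rfl⟩ := hx
    filter_upwards [he.eventually_sum_mul r] with s hs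
    rw [← NUModule.mul_smul, hs]
  | zero => simp
  | add x y _ _ hx hy =>
    filter_upwards [hx, hy] with s h1 h2
    rw [smul_add, h1, h2]
  | neg x _ hx =>
    filter_upwards [hx] with s h1
    rw [smul_neg, h1]

theorem HasEnoughIdempotents.hasLocalUnits_self (he : HasEnoughIdempotents e) :
    HasLocalUnits R R := fun x =>
  let ⟨_, hs⟩ := (he.eventually_sum_mul x).exists
  ⟨_, hs⟩

theorem HasEnoughIdempotents.hasLocalUnits (he : HasEnoughIdempotents e)
    (hN : IsUnitary R N) : HasLocalUnits R N := fun x =>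
  let ⟨_, hs⟩ := (he.eventually_sum_smul hN x).exists
  ⟨_, hs⟩

/-- For idempotents, `R a ≅ R b` exactly if `a = x y` and `b = y x` with `x ∈ a R b` and
`y ∈ b R a`. -/
theorem nuIso_leftIdeal_iff {a b : R} (ha : a * a = a) (hb : b * b = b) :
    NUIso R (leftIdeal a).Carrier (leftIdeal b).Carrier ↔
      ∃ x y, a * x = x ∧ x * b = x ∧ b * y = y ∧ y * a = y ∧ x * y = a ∧ y * x = b := by
  constructor
  · rintro ⟨φ, hφ⟩
    have hφ' : ∀ (r : R) z, φ.symm (r • z) = r • φ.symm z := fun r z => by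
      rw [φ.symm_apply_eq, hφ, φ.apply_symm_apply]
    let ea : (leftIdeal a).Carrier := ⟨a, a, ha⟩
    let eb : (leftIdeal b).Carrier := ⟨b, b, hb⟩
    have hxb := mul_eq_of_mem_leftIdeal hb (φ ea).2
    have hya := mul_eq_of_mem_leftIdeal ha (φ.symm eb).2
    refine ⟨φ ea, φ.symm eb, ?_, hxb, ?_, hya, ?_, ?_⟩
    · exact congrArg Subtype.val
        ((hφ a ea).symm.trans (congrArg φ (Subtype.ext ha : a • ea = ea)))
    · exact congrArg Subtype.val
        ((hφ' b eb).symm.trans (congrArg φ.symm (Subtype.ext hb : b • eb = eb)))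
    · have h : (φ ea : R) • eb = φ ea := Subtype.ext hxb
      refine congrArg Subtype.val (?_ : (φ ea : R) • φ.symm eb = ea)
      rw [← hφ', h, φ.symm_apply_apply]
    · have h : (φ.symm eb : R) • ea = φ.symm eb := Subtype.ext hya
      refine congrArg Subtype.val (?_ : (φ.symm eb : R) • φ ea = eb)
      rw [← hφ, h, φ.apply_symm_apply]
  · rintro ⟨x, y, -, hxb, -, hya, hxy, hyx⟩
    refine ⟨{ toFun := fun z => ⟨z * x, z * x, by rw [← hxb]; simp [mul_assoc, hb]⟩
              invFun := fun z => ⟨z * y, z * y, by rw [← hya]; simp [mul_assoc, ha]⟩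
              left_inv := fun z => Subtype.ext ?_
              right_inv := fun z => Subtype.ext ?_
              map_add' := fun z w => Subtype.ext (add_mul _ _ _) }, fun r z => Subtype.ext ?_⟩
    · change (z : R) * x * y = z
      rw [mul_assoc, hxy, mul_eq_of_mem_leftIdeal ha z.2]
    · change (z : R) * y * x = z
      rw [mul_assoc, hyx, mul_eq_of_mem_leftIdeal hb z.2]
    · exact mul_assoc r z x

variable {ι : Type*} [LinearOrder ι] {A : OrdPartition I ι}

/-- The trace of the projectives `R e r` of lower level in `R e t` is the sum of the
`R e r R e t`. -/
theorem mem_lowerTrace_iff (idem : ∀ i, e i * e i = e i) {i : ι} {t : I}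
    (x : (leftIdeal (e t)).Carrier) :
    x ∈ (lowerTrace e A i t).toAddSubgroup ↔
      (x : R) ∈ AddSubgroup.closure {y : R | ∃ r ∈ A.below i, ∃ a b, y = a * e r * b * e t} := by
  classical
  set C := AddSubgroup.closure {y : R | ∃ r ∈ A.below i, ∃ a b, y = a * e r * b * e t}
  constructor
  · intro hx
    suffices h : (lowerTrace e A i t).toAddSubgroup ≤
        C.comap (leftIdeal (e t)).toAddSubgroup.subtype from h hx
    refine iSup_le ?_
    rintro φ _ ⟨w, rfl⟩
    change (φ.toAddMonoidHom w : R) ∈ C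
    induction w using DFinsupp.induction with
    | h0 => rw [map_zero]; exact C.zero_mem
    | ha r y w _ _ ih =>
      rw [map_add]
      refine C.add_mem (AddSubgroup.subset_closure ?_) ih
      let er : (leftIdeal (e (r : I))).Carrier := ⟨e r, e r, idem r⟩
      have hy : DFinsupp.single r y =
          (y : R) • (DFinsupp.single r er : LowerProj e A i) := by
        refine Eq.trans ?_ (DFinsupp.mapRange_single (f := fun _ z => (y : R) • z)
          (hf := fun _ => smul_zero _)).symm
        exact congrArg _ (Subtype.ext (mul_eq_of_mem_leftIdeal (idem r) y.2).symm)
      obtain ⟨b, hb⟩ := mem_leftIdeal.1 (φ.toAddMonoidHom (DFinsupp.single r er)).2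
      obtain ⟨a, ha⟩ := mem_leftIdeal.1 y.2
      refine ⟨r, r.2, a, b, ?_⟩
      have h1 : φ.toAddMonoidHom (DFinsupp.single r y) =
          (y : R) • φ.toAddMonoidHom (DFinsupp.single r er) := by
        rw [hy]
        exact φ.map_smul _ _
      rw [h1, NUSubmodule.coe_smul, ← hb, ← ha, smul_eq_mul, mul_assoc _ b]
  · intro hx
    suffices h : C ≤ (lowerTrace e A i t).toAddSubgroup.map
        (leftIdeal (e t)).toAddSubgroup.subtype by
      obtain ⟨x', hx', hxx⟩ := h hx
      exact (Subtype.ext hxx : x' = x) ▸ hx'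
    refine (AddSubgroup.closure_le _).2 ?_
    rintro _ ⟨r, hr, a, b, rfl⟩
    let φ : NUHom R (LowerProj e A i) (leftIdeal (e t)).Carrier :=
      { toFun := fun w => ⟨w ⟨r, hr⟩ * (b * e t), w ⟨r, hr⟩ * b, mul_assoc _ _ _⟩
        map_zero' := Subtype.ext (zero_mul _)
        map_add' := fun w w' => Subtype.ext (add_mul _ _ _)
        map_smul := fun s w => Subtype.ext (mul_assoc s _ _) }
    refine ⟨φ.toAddMonoidHom (DFinsupp.single ⟨r, hr⟩ ⟨a * e r, a, rfl⟩),
      AddSubgroup.mem_iSup_of_mem φ ⟨_, rfl⟩, ?_⟩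
    change ((DFinsupp.single (⟨r, hr⟩ : A.below i) (⟨a * e r, a, rfl⟩ :
      (leftIdeal (e r)).Carrier) : LowerProj e A i) ⟨r, hr⟩ : R) * (b * e t) = _
    rw [DFinsupp.single_eq_same, mul_assoc _ b]

end EnoughIdempotents

/-! ### The triangular matrix algebra is basic -/

section Ring

variable {R I : Type*} [NonUnitalRing R] {e : I → R}

/-- The opposite of an algebra with enough idempotents. -/
theorem HasEnoughIdempotents.op (he : HasEnoughIdempotents e) :
    HasEnoughIdempotents fun i => MulOpposite.op (e i) := by
  refine .of_sum (fun i => ?_) (fun i j hij => ?_) ?_ ?_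
  · rw [← MulOpposite.op_mul, he.idem]
  · rw [← MulOpposite.op_mul, he.orth j i hij.symm, MulOpposite.op_zero]
  · have h : ⨆ i, (leftIdeal (e i)).toAddSubgroup ≤
        (⨆ i, rightIdeal (MulOpposite.op (e i))).comap
          (MulOpposite.opAddEquiv : R ≃+ Rᵐᵒᵖ).toAddMonoidHom := by
      refine iSup_le fun i => ?_
      rintro _ ⟨y, rfl⟩
      exact AddSubgroup.mem_iSup_of_mem i ⟨MulOpposite.op y, rfl⟩
    rw [he.left_sum] at h
    exact (AddSubgroup.eq_top_iff' _).2 fun x => h (AddSubgroup.mem_top x.unop)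
  · have h : ⨆ i, rightIdeal (e i) ≤
        (⨆ i, (leftIdeal (MulOpposite.op (e i))).toAddSubgroup).comap
          (MulOpposite.opAddEquiv : R ≃+ Rᵐᵒᵖ).toAddMonoidHom := by
      refine iSup_le fun i => ?_
      rintro _ ⟨y, rfl⟩
      exact AddSubgroup.mem_iSup_of_mem i ⟨MulOpposite.op y, rfl⟩
    rw [he.right_sum] at h
    exact (AddSubgroup.eq_top_iff' _).2 fun x => h (AddSubgroup.mem_top x.unop)

/-- If `x` is idempotent, `x y = 0` and `x + y = 0`, then `x = x (x + y) = 0`. -/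
theorem eq_zero_of_idem_of_orth {x y : R} (h1 : x * x = x) (h2 : x * y = 0) (h3 : x + y = 0) :
    x = 0 := by
  have h : x * (x + y) = x := by rw [mul_add, h1, h2, add_zero]
  rw [← h, h3, mul_zero]

end Ring

theorem isFiniteLength_of_le_map {K V W : Type*} [CommRing K] [AddCommGroup V] [Module K V]
    [AddCommGroup W] [Module K W] (ι : V →ₗ[K] W) {P : Submodule K V} {Q : Submodule K W}
    (hP : IsFiniteLength K P) (h : Q ≤ P.map ι) : IsFiniteLength K Q :=
  (hP.of_surjective (ι.submoduleMap_surjective P)).of_injective (Submodule.inclusion_injective h)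

namespace TriMat

section Components

variable {U T M : Type*} [NonUnitalRing U] [NonUnitalRing T] [AddCommGroup M]

/-- The projection to the upper left corner. -/
def prT : TriMat T M U →+ T := ⟨⟨fun x => x.t, rfl⟩, fun _ _ => rfl⟩

/-- The projection to the lower right corner. -/
def prU : TriMat T M U →+ U := ⟨⟨fun x => x.u, rfl⟩, fun _ _ => rfl⟩

variable (U T M)

/-- The embedding of the upper left corner. -/
def inT : T →+ TriMat T M U :=
  ⟨⟨fun t => ⟨t, 0, 0⟩, rfl⟩, fun x y => by ext <;> simp⟩

/-- The embedding of the lower left corner. -/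
def inM : M →+ TriMat T M U :=
  ⟨⟨fun m => ⟨0, m, 0⟩, rfl⟩, fun x y => by ext <;> simp⟩

/-- The embedding of the lower right corner. -/
def inU : U →+ TriMat T M U :=
  ⟨⟨fun u => ⟨0, 0, u⟩, rfl⟩, fun x y => by ext <;> simp⟩

variable {U T M}

@[simp] theorem prT_apply (x : TriMat T M U) : prT x = x.t := rfl
@[simp] theorem prU_apply (x : TriMat T M U) : prU x = x.u := rfl
@[simp] theorem inT_apply (t : T) : inT U T M t = ⟨t, 0, 0⟩ := rfl
@[simp] theorem inM_apply (m : M) : inM U T M m = ⟨0, m, 0⟩ := rfl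
@[simp] theorem inU_apply (u : U) : inU U T M u = ⟨0, 0, u⟩ := rfl

theorem eq_sum (x : TriMat T M U) : x = inT U T M x.t + inM U T M x.m + inU U T M x.u := by
  ext <;> simp

variable {I J : Type*} (e : I → U) (f : J → T)

@[simp] theorem idem_inl (i : I) : idem M e f (Sum.inl i) = ⟨0, 0, e i⟩ := rfl
@[simp] theorem idem_inr (j : J) : idem M e f (Sum.inr j) = ⟨f j, 0, 0⟩ := rfl

end Components

variable {U T M I J : Type*} [NonUnitalRing U] [NonUnitalRing T] [AddCommGroup M]
  [NUModule U M] [NUModule Tᵐᵒᵖ M]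

/-- The off-diagonal part of the triangular matrix algebra holds no non-zero idempotent. -/
theorem eq_zero_of_idem {x : TriMat T M U} (hx : x * x = x) (ht : x.t = 0) (hu : x.u = 0) :
    x = 0 := by
  have hm := congrArg TriMat.m hx
  simp only [mul_m, ht, hu, MulOpposite.op_zero, nu_zero_smul, add_zero] at hm
  ext
  · exact ht
  · exact hm.symm
  · exact hu

variable [SMulCommClass U Tᵐᵒᵖ M] {e : I → U} {f : J → T}

theorem hasEnoughIdempotents (hU : HasEnoughIdempotents e) (hT : HasEnoughIdempotents f)
    (hUM : IsUnitary U M) (hMT : IsUnitary Tᵐᵒᵖ M) : HasEnoughIdempotents (idem M e f) := by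
  refine .of_sum ?_ ?_ ?_ ?_
  · rintro (i | j)
    · ext <;> simp [hU.idem]
    · ext <;> simp [hT.idem]
  · rintro (i | j) (i' | j') h
    · ext <;> simp [hU.orth i i' (by simpa using h)]
    · ext <;> simp
    · ext <;> simp
    · ext <;> simp [hT.orth j j' (by simpa using h)]
  · set S := ⨆ r, rightIdeal (idem M e f r)
    have hS : ∀ r x, idem M e f r * x ∈ S := fun r x => AddSubgroup.mem_iSup_of_mem r ⟨x, rfl⟩
    have h1 : ⨆ j, rightIdeal (f j) ≤ S.comap (inT U T M) := by
      refine iSup_le fun j => ?_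
      rintro _ ⟨y, rfl⟩
      change inT U T M (f j * y) ∈ S
      convert hS (Sum.inr j) (inT U T M y) using 1
      ext <;> simp
    have h2 : ⨆ i, rightIdeal (e i) ≤ S.comap (inU U T M) := by
      refine iSup_le fun i => ?_
      rintro _ ⟨y, rfl⟩
      change inU U T M (e i * y) ∈ S
      convert hS (Sum.inl i) (inU U T M y) using 1
      ext <;> simp
    rw [hT.right_sum] at h1
    rw [hU.right_sum] at h2
    refine (AddSubgroup.eq_top_iff' _).2 fun x => ?_
    rw [eq_sum x]
    refine S.add_mem (S.add_mem (h1 (AddSubgroup.mem_top _)) ?_) (h2 (AddSubgroup.mem_top _))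
    obtain ⟨s, hs⟩ := (hU.eventually_sum_smul hUM x.m).exists
    rw [← hs, sum_nu_smul, map_sum]
    refine S.sum_mem fun i _ => ?_
    convert hS (Sum.inl i) (inM U T M x.m) using 1
    ext <;> simp
  · set S := ⨆ r, (leftIdeal (idem M e f r)).toAddSubgroup
    have hS : ∀ r x, x * idem M e f r ∈ S := fun r x => AddSubgroup.mem_iSup_of_mem r ⟨x, rfl⟩
    have h1 : ⨆ j, (leftIdeal (f j)).toAddSubgroup ≤ S.comap (inT U T M) := by
      refine iSup_le fun j => ?_
      rintro _ ⟨y, rfl⟩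
      change inT U T M (y * f j) ∈ S
      convert hS (Sum.inr j) (inT U T M y) using 1
      ext <;> simp
    have h2 : ⨆ i, (leftIdeal (e i)).toAddSubgroup ≤ S.comap (inU U T M) := by
      refine iSup_le fun i => ?_
      rintro _ ⟨y, rfl⟩
      change inU U T M (y * e i) ∈ S
      convert hS (Sum.inl i) (inU U T M y) using 1
      ext <;> simp
    rw [hT.left_sum] at h1
    rw [hU.left_sum] at h2
    refine (AddSubgroup.eq_top_iff' _).2 fun x => ?_
    rw [eq_sum x]
    refine S.add_mem (S.add_mem (h1 (AddSubgroup.mem_top _)) ?_) (h2 (AddSubgroup.mem_top _))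
    obtain ⟨s, hs⟩ := (hT.op.eventually_sum_smul hMT x.m).exists
    rw [← hs, sum_nu_smul, map_sum]
    refine S.sum_mem fun j _ => ?_
    convert hS (Sum.inr j) (inM U T M x.m) using 1
    ext <;> simp

theorem isPrimitiveIdem_idem (hU : ∀ i, IsPrimitiveIdem (e i)) (hT : ∀ j, IsPrimitiveIdem (f j))
    (r : I ⊕ J) : IsPrimitiveIdem (idem M e f r) := by
  rcases r with i | j
  · obtain ⟨h0, hi, hp⟩ := hU i
    refine ⟨fun h => h0 (congrArg TriMat.u h), by ext <;> simp [hi], ?_⟩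
    intro x y hx hy hxy hyx hs
    have ht : x.t + y.t = 0 := congrArg TriMat.t hs
    have hxt := eq_zero_of_idem_of_orth (congrArg TriMat.t hx) (congrArg TriMat.t hxy) ht
    have hyt := eq_zero_of_idem_of_orth (congrArg TriMat.t hy)
      (congrArg TriMat.t hyx) ((add_comm _ _).trans ht)
    exact (hp x.u y.u (congrArg TriMat.u hx) (congrArg TriMat.u hy) (congrArg TriMat.u hxy)
      (congrArg TriMat.u hyx) (congrArg TriMat.u hs)).imp (eq_zero_of_idem hx hxt)
      (eq_zero_of_idem hy hyt)
  · obtain ⟨h0, hi, hp⟩ := hT j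
    refine ⟨fun h => h0 (congrArg TriMat.t h), by ext <;> simp [hi], ?_⟩
    intro x y hx hy hxy hyx hs
    have hu : x.u + y.u = 0 := congrArg TriMat.u hs
    have hxu := eq_zero_of_idem_of_orth (congrArg TriMat.u hx) (congrArg TriMat.u hxy) hu
    have hyu := eq_zero_of_idem_of_orth (congrArg TriMat.u hy)
      (congrArg TriMat.u hyx) ((add_comm _ _).trans hu)
    exact (hp x.t y.t (congrArg TriMat.t hx) (congrArg TriMat.t hy) (congrArg TriMat.t hxy)
      (congrArg TriMat.t hyx) (congrArg TriMat.t hs)).imp (eq_zero_of_idem hx · hxu)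
      (eq_zero_of_idem hy · hyu)

theorem not_nuIso_idem (idemU : ∀ i, e i * e i = e i) (idemT : ∀ j, f j * f j = f j)
    (hU0 : ∀ i, e i ≠ 0) (hT0 : ∀ j, f j ≠ 0)
    (hU : ∀ i i', e i ≠ e i' → ¬ NUIso U (leftIdeal (e i)).Carrier (leftIdeal (e i')).Carrier)
    (hT : ∀ j j', f j ≠ f j' → ¬ NUIso T (leftIdeal (f j)).Carrier (leftIdeal (f j')).Carrier)
    (r s : I ⊕ J) (hrs : idem M e f r ≠ idem M e f s) :
    ¬ NUIso (TriMat T M U) (leftIdeal (idem M e f r)).Carrier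
      (leftIdeal (idem M e f s)).Carrier := by
  have hidem : ∀ r, idem M e f r * idem M e f r = idem M e f r := by
    rintro (i | j)
    · ext <;> simp [idemU]
    · ext <;> simp [idemT]
  rw [nuIso_leftIdeal_iff (hidem r) (hidem s)]
  rintro ⟨x, y, h1, h2, h3, h4, h5, h6⟩
  rcases r with i | j <;> rcases s with i' | j'
  · refine hU i i' (fun h => hrs (by simp [h])) ((nuIso_leftIdeal_iff (idemU i) (idemU i')).2
      ⟨x.u, y.u, congrArg TriMat.u h1, congrArg TriMat.u h2, congrArg TriMat.u h3,
        congrArg TriMat.u h4, congrArg TriMat.u h5, congrArg TriMat.u h6⟩)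
  · have hx : x.u = 0 := by simpa using (congrArg TriMat.u h2).symm
    have h := congrArg TriMat.u h5
    rw [mul_u, hx, zero_mul] at h
    exact hU0 i h.symm
  · have hx : x.t = 0 := by simpa using (congrArg TriMat.t h2).symm
    have h := congrArg TriMat.t h5
    rw [mul_t, hx, zero_mul] at h
    exact hT0 j h.symm
  · refine hT j j' (fun h => hrs (by simp [h])) ((nuIso_leftIdeal_iff (idemT j) (idemT j')).2
      ⟨x.t, y.t, congrArg TriMat.t h1, congrArg TriMat.t h2, congrArg TriMat.t h3,
        congrArg TriMat.t h4, congrArg TriMat.t h5, congrArg TriMat.t h6⟩)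

variable {K : Type*} [CommRing K] [Module K U] [IsScalarTower K U U] [SMulCommClass K U U]
  [Module K T] [IsScalarTower K T T] [SMulCommClass K T T]
  [Module K M] [IsScalarTower K U M] [SMulCommClass K U M]
  [IsScalarTower K Tᵐᵒᵖ M] [SMulCommClass K Tᵐᵒᵖ M]

theorem isFiniteLength_corner_idem (hU : ∀ i i', IsFiniteLength K (corner K (e i') (e i)))
    (hT : ∀ j j', IsFiniteLength K (corner K (f j') (f j)))
    (hM : ∀ i j, IsFiniteLength K (bimoduleCorner K M (e i) (f j))) (r s : I ⊕ J) :
    IsFiniteLength K (corner K (idem M e f s) (idem M e f r)) := by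
  rcases r with i | j <;> rcases s with i' | j'
  · refine isFiniteLength_of_le_map (P := corner K (e i') (e i))
      { inU U T M with map_smul' := fun k x => by ext <;> simp } (hU i i') ?_
    rintro _ ⟨x, rfl⟩
    refine ⟨e i' * x.u * e i, ⟨x.u, rfl⟩, ?_⟩
    change inU U T M _ = idem M e f (Sum.inl i') * x * idem M e f (Sum.inl i)
    ext <;> simp [nu_zero_smul]
  · have h : corner K (idem M e f (Sum.inr j')) (idem M e f (Sum.inl i)) = ⊥ := by
      refine (Submodule.eq_bot_iff _).2 ?_
      rintro _ ⟨x, rfl⟩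
      change idem M e f (Sum.inr j') * x * idem M e f (Sum.inl i) = 0
      ext <;> simp [nu_zero_smul]
    rw [h]
    exact .of_subsingleton
  · refine isFiniteLength_of_le_map (P := bimoduleCorner K M (e i') (f j))
      { inM U T M with map_smul' := fun k x => by ext <;> simp } (hM i' j) ?_
    rintro _ ⟨x, rfl⟩
    refine ⟨e i' • (MulOpposite.op (f j) • x.m), ⟨x.m, rfl⟩, ?_⟩
    change inM U T M _ = idem M e f (Sum.inl i') * x * idem M e f (Sum.inr j)
    ext <;> simp [smul_comm]
  · refine isFiniteLength_of_le_map (P := corner K (f j') (f j))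
      { inT U T M with map_smul' := fun k x => by ext <;> simp } (hT j j') ?_
    rintro _ ⟨x, rfl⟩
    refine ⟨f j' * x.t * f j, ⟨x.t, rfl⟩, ?_⟩
    change inT U T M _ = idem M e f (Sum.inr j') * x * idem M e f (Sum.inr j)
    ext <;> simp [nu_zero_smul]

theorem isBasic (hU : IsBasic K e) (hT : IsBasic K f) (hUM : IsUnitary U M)
    (hMT : IsUnitary Tᵐᵒᵖ M) (hM : ∀ i j, IsFiniteLength K (bimoduleCorner K M (e i) (f j))) :
    IsBasic K (idem M e f) where
  toHasEnoughIdempotents :=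
    hasEnoughIdempotents hU.toHasEnoughIdempotents hT.toHasEnoughIdempotents hUM hMT
  homFinite := isFiniteLength_corner_idem hU.homFinite hT.homFinite hM
  primitive := isPrimitiveIdem_idem hU.primitive hT.primitive
  not_iso := not_nuIso_idem hU.idem hT.idem (fun i => (hU.primitive i).1)
    (fun j => (hT.primitive j).1) hU.not_iso hT.not_iso

end TriMat

/-! ### Standard modules of the triangular matrix algebra -/

/-- The restriction of an additive map to submodules, possibly over different rings. -/
def restrictHom {R R' N N' : Type*} [NonUnitalRing R] [NonUnitalRing R'] [AddCommGroup N]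
    [NUModule R N] [AddCommGroup N'] [NUModule R' N'] (φ : N →+ N') (L : NUSubmodule R N)
    (L' : NUSubmodule R' N') (h : ∀ x ∈ L.toAddSubgroup, φ x ∈ L'.toAddSubgroup) :
    L.Carrier →+ L'.Carrier :=
  (φ.comp L.toAddSubgroup.subtype).codRestrict L'.toAddSubgroup fun x => h x x.2

section Join

variable {I J ι κ : Type*} [LinearOrder ι] [LinearOrder κ] {A : OrdPartition I ι}
  {B : OrdPartition J κ}

theorem OrdPartition.exists_mem_block (A : OrdPartition I ι) (r : I) : ∃ i, r ∈ A.block i :=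
  Set.mem_iUnion.1 (A.cover ▸ Set.mem_univ r)

theorem OrdPartition.mem_join_below_inl {i : ι} {r : I ⊕ J} :
    r ∈ (A.join B).below (toLex (Sum.inl i)) ↔ ∃ t ∈ A.below i, Sum.inl t = r := by
  constructor
  · rintro ⟨k, hk, hr⟩
    rcases h : ofLex k with i' | j
    · obtain rfl : k = toLex (Sum.inl i') := h
      obtain ⟨t, ht, rfl⟩ := hr
      exact ⟨t, ⟨i', Sum.Lex.inl_lt_inl_iff.1 hk, ht⟩, rfl⟩
    · obtain rfl : k = toLex (Sum.inr j) := h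
      exact absurd hk Sum.Lex.not_inr_lt_inl
  · rintro ⟨t, ⟨i', hi, ht⟩, rfl⟩
    exact ⟨toLex (Sum.inl i'), Sum.Lex.inl_lt_inl_iff.2 hi, t, ht, rfl⟩

theorem OrdPartition.mem_join_below_inr {j : κ} {r : I ⊕ J} :
    r ∈ (A.join B).below (toLex (Sum.inr j)) ↔
      (∃ t, Sum.inl t = r) ∨ ∃ t ∈ B.below j, Sum.inr t = r := by
  constructor
  · rintro ⟨k, hk, hr⟩
    rcases h : ofLex k with i' | j'
    · obtain rfl : k = toLex (Sum.inl i') := h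
      obtain ⟨t, ht, rfl⟩ := hr
      exact .inl ⟨t, rfl⟩
    · obtain rfl : k = toLex (Sum.inr j') := h
      obtain ⟨t, ht, rfl⟩ := hr
      exact .inr ⟨t, ⟨j', Sum.Lex.inr_lt_inr_iff.1 hk, ht⟩, rfl⟩
  · rintro (⟨t, rfl⟩ | ⟨t, ⟨j', hj, ht⟩, rfl⟩)
    · obtain ⟨i, hi⟩ := A.exists_mem_block t
      exact ⟨toLex (Sum.inl i), Sum.Lex.inl_lt_inr _ _, t, hi, rfl⟩
    · exact ⟨toLex (Sum.inr j'), Sum.Lex.inr_lt_inr_iff.2 hj, t, ht, rfl⟩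

theorem OrdPartition.mem_join_block {p : (ι ⊕ₗ κ) × (I ⊕ J)}
    (hp : p.2 ∈ (A.join B).block p.1) :
    (∃ i, ∃ t ∈ A.block i, p = (toLex (Sum.inl i), Sum.inl t)) ∨
      ∃ j, ∃ t ∈ B.block j, p = (toLex (Sum.inr j), Sum.inr t) := by
  obtain ⟨k, r⟩ := p
  rcases h : ofLex k with i | j
  · obtain rfl : k = toLex (Sum.inl i) := h
    obtain ⟨t, ht, rfl⟩ := hp
    exact .inl ⟨i, t, ht, rfl⟩
  · obtain rfl : k = toLex (Sum.inr j) := h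
    obtain ⟨t, ht, rfl⟩ := hp
    exact .inr ⟨j, t, ht, rfl⟩

end Join

namespace TriMat

variable {U T M I J : Type*} [NonUnitalRing U] [NonUnitalRing T] [AddCommGroup M]
  [NUModule U M] [NUModule Tᵐᵒᵖ M] [SMulCommClass U Tᵐᵒᵖ M] (e : I → U) (f : J → T)

variable (M) in
/-- The isomorphism from `Λ g_t` to `U e_t`, for an index `t` of the lower right corner. -/
def leftIdealInl (t : I) :
    (leftIdeal (idem M e f (Sum.inl t))).Carrier ≃+ (leftIdeal (e t)).Carrier where
  toFun := restrictHom prU _ _ fun x hx => by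
    obtain ⟨y, rfl⟩ := mem_leftIdeal.1 hx
    exact mul_mem_leftIdeal y.u (e t)
  invFun := restrictHom (inU U T M) _ _ fun x hx => by
    obtain ⟨y, rfl⟩ := mem_leftIdeal.1 hx
    exact mem_leftIdeal.2 ⟨inU U T M y, by ext <;> simp⟩
  left_inv x := by
    obtain ⟨x, y, rfl⟩ := x
    refine Subtype.ext (TriMat.ext ?_ ?_ rfl)
    · exact (mul_zero y.t).symm
    · change 0 = MulOpposite.op (0 : T) • y.m + y.u • (0 : M)
      simp [nu_zero_smul]
  right_inv _ := rfl
  map_add' _ _ := rfl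

theorem leftIdealInl_smul (t : I) (r : TriMat T M U) x :
    leftIdealInl M e f t (r • x) = r.u • leftIdealInl M e f t x := rfl

variable (M) in
/-- The projection from `Λ g_t` to `T f_t`, for an index `t` of the upper left corner. -/
def leftIdealInr (t : J) :
    (leftIdeal (idem M e f (Sum.inr t))).Carrier →+ (leftIdeal (f t)).Carrier :=
  restrictHom prT _ _ fun x hx => by
    obtain ⟨y, rfl⟩ := mem_leftIdeal.1 hx
    exact mul_mem_leftIdeal y.t (f t)

theorem leftIdealInr_smul (t : J) (r : TriMat T M U) x :
    leftIdealInr M e f t (r • x) = r.t • leftIdealInr M e f t x := rfl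

variable {e f}

theorem mem_leftIdeal_inr_iff {t : J} {x : TriMat T M U} :
    x ∈ (leftIdeal (idem M e f (Sum.inr t))).toAddSubgroup ↔
      x.t ∈ (leftIdeal (f t)).toAddSubgroup ∧
        x.m ∈ (colSubmodule U M (f t)).toAddSubgroup ∧ x.u = 0 := by
  constructor
  · rintro ⟨y, rfl⟩
    refine ⟨mul_mem_leftIdeal _ _, ⟨y.m, ?_⟩, mul_zero y.u⟩
    change _ = MulOpposite.op (f t) • y.m + y.u • (0 : M)
    rw [smul_zero, add_zero]
    rfl
  · rintro ⟨⟨y, hy⟩, ⟨m, hm⟩, hu⟩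
    have hy' : y * f t = x.t := hy
    have hm' : MulOpposite.op (f t) • m = x.m := hm
    exact mem_leftIdeal.2 ⟨⟨y, m, 0⟩, by ext <;> simp [hy', hm', hu]⟩

theorem leftIdealInr_surjective (t : J) : Function.Surjective (leftIdealInr M e f t) := by
  rintro ⟨_, y, rfl⟩
  exact ⟨⟨inT U T M (y * f t), inT U T M y, by ext <;> simp⟩, rfl⟩

variable {ι κ : Type*} [LinearOrder ι] [LinearOrder κ] {A : OrdPartition I ι}
  {B : OrdPartition J κ}

/-- The trace in `Λ g_t`, for `t` in a block of `A`, is the trace in `U e_t`. -/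
theorem mem_lowerTrace_inl (hU : HasEnoughIdempotents e)
    (hΛ : HasEnoughIdempotents (idem M e f)) {i : ι} {t : I} (x) :
    x ∈ (lowerTrace (idem M e f) (A.join B) (toLex (Sum.inl i)) (Sum.inl t)).toAddSubgroup ↔
      leftIdealInl M e f t x ∈ (lowerTrace e A i t).toAddSubgroup := by
  rw [mem_lowerTrace_iff hΛ.idem, mem_lowerTrace_iff hU.idem]
  set C := AddSubgroup.closure
    {y : U | ∃ r ∈ A.below i, ∃ a b, y = a * e r * b * e t}
  set D := AddSubgroup.closure {y : TriMat T M U | ∃ r ∈ (A.join B).below (toLex (Sum.inl i)),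
    ∃ a b, y = a * idem M e f r * b * idem M e f (Sum.inl t)}
  constructor
  · intro hx
    suffices h : D ≤ C.comap prU from h hx
    refine (AddSubgroup.closure_le _).2 ?_
    rintro _ ⟨r, hr, a, b, rfl⟩
    obtain ⟨r, hr', rfl⟩ := OrdPartition.mem_join_below_inl.1 hr
    exact AddSubgroup.subset_closure ⟨r, hr', a.u, b.u, rfl⟩
  · intro hx
    suffices h : C ≤ D.comap (inU U T M) by
      rw [← (leftIdealInl M e f t).symm_apply_apply x]
      exact h hx
    refine (AddSubgroup.closure_le _).2 ?_
    rintro _ ⟨r, hr, a, b, rfl⟩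
    exact AddSubgroup.subset_closure ⟨Sum.inl r, OrdPartition.mem_join_below_inl.2 ⟨r, hr, rfl⟩,
      inU U T M a, inU U T M b, by ext <;> simp⟩

/-- The trace in `Λ g_t`, for `t` in a block of `B`, consists of the trace in `T f_t` and all of
`M f_t = U M f_t`. -/
theorem mem_lowerTrace_inr (hU : HasEnoughIdempotents e) (hT : HasEnoughIdempotents f)
    (hΛ : HasEnoughIdempotents (idem M e f)) (hUM : IsUnitary U M) {j : κ} {t : J} (x) :
    x ∈ (lowerTrace (idem M e f) (A.join B) (toLex (Sum.inr j)) (Sum.inr t)).toAddSubgroup ↔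
      leftIdealInr M e f t x ∈ (lowerTrace f B j t).toAddSubgroup := by
  rw [mem_lowerTrace_iff hΛ.idem, mem_lowerTrace_iff hT.idem]
  set C := AddSubgroup.closure
    {y : T | ∃ r ∈ B.below j, ∃ a b, y = a * f r * b * f t}
  set D := AddSubgroup.closure {y : TriMat T M U | ∃ r ∈ (A.join B).below (toLex (Sum.inr j)),
    ∃ a b, y = a * idem M e f r * b * idem M e f (Sum.inr t)}
  constructor
  · intro hx
    suffices h : D ≤ C.comap prT from h hx
    refine (AddSubgroup.closure_le _).2 ?_
    rintro _ ⟨r, hr, a, b, rfl⟩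
    rcases OrdPartition.mem_join_below_inr.1 hr with ⟨r, rfl⟩ | ⟨r, hr', rfl⟩
    · have h0 : prT (a * idem M e f (Sum.inl r) * b * idem M e f (Sum.inr t)) = 0 := by simp
      exact (congrArg (· ∈ C) h0).mpr C.zero_mem
    · exact AddSubgroup.subset_closure ⟨r, hr', a.t, b.t, rfl⟩
  · intro hx
    have h : C ≤ D.comap (inT U T M) := by
      refine (AddSubgroup.closure_le _).2 ?_
      rintro _ ⟨r, hr, a, b, rfl⟩
      exact AddSubgroup.subset_closure
        ⟨Sum.inr r, OrdPartition.mem_join_below_inr.2 (.inr ⟨r, hr, rfl⟩),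
          inT U T M a, inT U T M b, by ext <;> simp⟩
    obtain ⟨-, ⟨m, hm⟩, hu⟩ := (mem_leftIdeal_inr_iff (e := e)).1 x.2
    have hm' : MulOpposite.op (f t) • m = (x : TriMat T M U).m := hm
    rw [eq_sum (x : TriMat T M U), hu, map_zero, add_zero]
    refine D.add_mem (h hx) ?_
    obtain ⟨s, hs⟩ := (hU.eventually_sum_smul hUM m).exists
    rw [← hm', ← hs, ← smul_comm, sum_nu_smul, map_sum]
    refine D.sum_mem fun i _ => AddSubgroup.subset_closure
      ⟨Sum.inl i, OrdPartition.mem_join_below_inr.2 (.inl ⟨i, rfl⟩),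
        inU U T M (e i), inM U T M m, ?_⟩
    ext <;> simp [hU.idem, smul_comm]

/-- The standard modules of the blocks of `A` are those of `U`, with `T` and `M` acting as zero. -/
theorem exists_stdModule_equiv_inl (hU : HasEnoughIdempotents e)
    (hΛ : HasEnoughIdempotents (idem M e f)) (i : ι) (t : I) :
    ∃ ψ : StdModule (idem M e f) (A.join B) (toLex (Sum.inl i), Sum.inl t) ≃+
      StdModule e A (i, t), ∀ (r : TriMat T M U) x, ψ (r • x) = r.u • ψ x :=
  exists_quot_equiv (leftIdealInl M e f t).toAddMonoidHom (leftIdealInl M e f t).surjective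
    TriMat.u (leftIdealInl_smul e f t) _ _ (mem_lowerTrace_inl hU hΛ)

/-- The standard modules of the blocks of `B` are those of `T`, with `U` and `M` acting as zero. -/
theorem exists_stdModule_equiv_inr (hU : HasEnoughIdempotents e) (hT : HasEnoughIdempotents f)
    (hΛ : HasEnoughIdempotents (idem M e f)) (hUM : IsUnitary U M) (j : κ) (t : J) :
    ∃ ψ : StdModule (idem M e f) (A.join B) (toLex (Sum.inr j), Sum.inr t) ≃+
      StdModule f B (j, t), ∀ (r : TriMat T M U) x, ψ (r • x) = r.t • ψ x :=
  exists_quot_equiv (leftIdealInr M e f t) (leftIdealInr_surjective t)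
    TriMat.t (leftIdealInr_smul e f t) _ _ (mem_lowerTrace_inr hU hT hΛ hUM)

end TriMat

/-! ### Comparison of the filtrations -/

namespace TriMat

variable {U T M I J : Type*} [NonUnitalRing U] [NonUnitalRing T] [AddCommGroup M]
  [NUModule U M] [NUModule Tᵐᵒᵖ M] [SMulCommClass U Tᵐᵒᵖ M] {e : I → U} {f : J → T}
  {ι κ : Type*} [LinearOrder ι] [LinearOrder κ] {A : OrdPartition I ι} {B : OrdPartition J κ}

/-- For the blocks of `A`, the condition defining standard stratification is the same over `Λ` and
over `U`. -/
theorem isGoodBelow_lowerTrace_inl_iff (hU : HasEnoughIdempotents e)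
    (hΛ : HasEnoughIdempotents (idem M e f)) (i : ι) (t : I) :
    IsGoodBelow (idem M e f) (A.join B) (toLex (Sum.inl i))
        (lowerTrace (idem M e f) (A.join B) (toLex (Sum.inl i)) (Sum.inl t)).Carrier ↔
      IsGoodBelow e A i (lowerTrace e A i t).Carrier := by
  let φ : (lowerTrace e A i t).Carrier →+
      (lowerTrace (idem M e f) (A.join B) (toLex (Sum.inl i)) (Sum.inl t)).Carrier :=
    restrictHom (leftIdealInl M e f t).symm.toAddMonoidHom _ _ fun x hx =>
      (mem_lowerTrace_inl hU hΛ _).2 (((leftIdealInl M e f t).apply_symm_apply x).symm ▸ hx)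
  have hφi : Function.Injective φ := fun x y h =>
    Subtype.ext ((leftIdealInl M e f t).symm.injective (congrArg Subtype.val h))
  have hφs : Function.Surjective φ := fun x =>
    ⟨⟨leftIdealInl M e f t x, (mem_lowerTrace_inl hU hΛ _).1 x.2⟩,
      Subtype.ext ((leftIdealInl M e f t).symm_apply_apply x)⟩
  have hφ : ∀ (r : TriMat T M U) x, φ (r.u • x) = r • φ x := fun r x => by
    refine Subtype.ext ((leftIdealInl M e f t).injective ?_)
    change leftIdealInl M e f t
      ((leftIdealInl M e f t).symm (r.u • (x : (leftIdeal (e t)).Carrier))) =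
      r.u • leftIdealInl M e f t ((leftIdealInl M e f t).symm x)
    simp only [AddEquiv.apply_symm_apply]
  have hlu := (hU.hasLocalUnits_self).carrier (leftIdeal (e t))
  constructor
  · intro h
    refine h.truncate φ hφi (inU U T M) (fun r x => hφ (inU U T M r) x) (fun r x => hφs _)
      (hlu.carrier _) (fun p _ => (hU.hasLocalUnits_self.carrier _).quot _) fun p hp => .inl ?_
    rcases OrdPartition.mem_join_block hp.2 with ⟨i', t', ht, rfl⟩ | ⟨j', t', ht, rfl⟩
    · obtain ⟨ψ, hψ⟩ := exists_stdModule_equiv_inl (A := A) (B := B) hU hΛ i' t'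
      exact ⟨(i', t'), ⟨Sum.Lex.inl_lt_inl_iff.1 hp.1, ht⟩, ψ, fun r x => hψ (inU U T M r) x⟩
    · exact absurd hp.1 Sum.Lex.not_inr_lt_inl
  · intro h
    refine h.inflate φ ⟨hφi, hφs⟩ TriMat.u hφ fun p hp => ?_
    exact ⟨(toLex (Sum.inl p.1), Sum.inl p.2),
      ⟨Sum.Lex.inl_lt_inl_iff.2 hp.1, p.2, hp.2, rfl⟩, exists_stdModule_equiv_inl hU hΛ p.1 p.2⟩

/-- For the blocks of `B`, the condition defining standard stratification over `Λ` splits along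
`0 ⟶ M f_t ⟶ τ ⟶ τ_T ⟶ 0`. -/
theorem isGoodBelow_lowerTrace_inr_iff (hU : HasEnoughIdempotents e) (hT : HasEnoughIdempotents f)
    (hΛ : HasEnoughIdempotents (idem M e f)) (hUM : IsUnitary U M) (j : κ) (t : J) :
    IsGoodBelow (idem M e f) (A.join B) (toLex (Sum.inr j))
        (lowerTrace (idem M e f) (A.join B) (toLex (Sum.inr j)) (Sum.inr t)).Carrier ↔
      IsGood e A (colSubmodule U M (f t)).Carrier ∧
        IsGoodBelow f B j (lowerTrace f B j t).Carrier := by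
  set N := lowerTrace (idem M e f) (A.join B) (toLex (Sum.inr j)) (Sum.inr t)
  have hN : ∀ x, x ∈ N.toAddSubgroup ↔
      leftIdealInr M e f t x ∈ (lowerTrace f B j t).toAddSubgroup :=
    mem_lowerTrace_inr hU hT hΛ hUM
  have hmem : ∀ x : N.Carrier, (x.1.1 : TriMat T M U).m ∈
      (colSubmodule U M (f t)).toAddSubgroup ∧ (x.1.1 : TriMat T M U).u = 0 := fun x =>
    (mem_leftIdeal_inr_iff.1 x.1.2).2
  let φM : (colSubmodule U M (f t)).Carrier →+ N.Carrier :=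
    ((inM U T M).comp (colSubmodule U M (f t)).toAddSubgroup.subtype).codRestrict
      (leftIdeal (idem M e f (Sum.inr t))).toAddSubgroup
      (fun m => mem_leftIdeal_inr_iff.2 ⟨AddSubgroup.zero_mem _, m.2, rfl⟩) |>.codRestrict
      N.toAddSubgroup fun m => (hN _).2 (AddSubgroup.zero_mem _)
  let φT : (lowerTrace f B j t).Carrier →+ N.Carrier :=
    (((inT U T M).comp (leftIdeal (f t)).toAddSubgroup.subtype).codRestrict
      (leftIdeal (idem M e f (Sum.inr t))).toAddSubgroup
      (fun y => mem_leftIdeal_inr_iff.2 ⟨y.2, AddSubgroup.zero_mem _, rfl⟩) |>.comp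
      (lowerTrace f B j t).toAddSubgroup.subtype).codRestrict
      N.toAddSubgroup fun y => (hN _).2 y.2
  let π : N.Carrier →+ (lowerTrace f B j t).Carrier :=
    restrictHom (leftIdealInr M e f t) _ _ fun x hx => (hN x).1 hx
  have hM1 : ∀ m, ((φM m).1.1 : TriMat T M U) = inM U T M m := fun _ => rfl
  have hT1 : ∀ y, ((φT y).1.1 : TriMat T M U) = inT U T M y.1.1 := fun _ => rfl
  have hN1 : ∀ (r : TriMat T M U) (x : N.Carrier),
      ((r • x).1.1 : TriMat T M U) = r * x.1.1 := fun _ _ => rfl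
  have hMi : Function.Injective φM := fun m m' h => Subtype.ext (congrArg (fun x => x.1.1.m) h)
  have hTi : Function.Injective φT := fun y y' h =>
    Subtype.ext (Subtype.ext (congrArg (fun x => x.1.1.t) h))
  have hMl : ∀ (r : TriMat T M U) m, φM (r.u • m) = r • φM m := fun r m => by
    refine Subtype.ext (Subtype.ext ?_)
    rw [hM1, hN1, hM1]
    ext <;> simp [nu_zero_smul]
  constructor
  · intro h
    constructor
    · refine h.truncate φM hMi (inU U T M) (fun u m => hMl (inU U T M u) m) (fun u x => ?_)
        ((hU.hasLocalUnits hUM).carrier _)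
        (fun p _ => (hU.hasLocalUnits_self.carrier _).quot _) fun p hp => ?_
      · refine ⟨u • ⟨_, (hmem x).1⟩, Subtype.ext (Subtype.ext ?_)⟩
        rw [hM1, hN1]
        ext <;> simp [(hmem x).2]
      · rcases OrdPartition.mem_join_block hp.2 with ⟨i', t', ht, rfl⟩ | ⟨j', t', ht, rfl⟩
        · obtain ⟨ψ, hψ⟩ := exists_stdModule_equiv_inl (A := A) (B := B) hU hΛ i' t'
          exact .inl ⟨(i', t'), ht, ψ, fun r x => hψ (inU U T M r) x⟩
        · obtain ⟨ψ, hψ⟩ := exists_stdModule_equiv_inr (A := A) (B := B) hU hT hΛ hUM j' t'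
          refine .inr fun r x => ψ.injective ?_
          rw [hψ, inU_apply, nu_zero_smul, map_zero]
    · refine h.truncate φT hTi (inT U T M) (fun s y => ?_) (fun s x => ?_)
        ((hT.hasLocalUnits_self.carrier _).carrier _)
        (fun p _ => (hT.hasLocalUnits_self.carrier _).quot _) fun p hp => ?_
      · refine Subtype.ext (Subtype.ext ?_)
        rw [hT1, hN1, hT1]
        ext <;> simp
      · refine ⟨s • π x, Subtype.ext (Subtype.ext ?_)⟩
        rw [hT1, hN1]
        ext
        · rfl
        · simp [nu_zero_smul]
        · simp
      · rcases OrdPartition.mem_join_block hp.2 with ⟨i', t', ht, rfl⟩ | ⟨j', t', ht, rfl⟩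
        · obtain ⟨ψ, hψ⟩ := exists_stdModule_equiv_inl (A := A) (B := B) hU hΛ i' t'
          refine .inr fun r x => ψ.injective ?_
          rw [hψ, inT_apply, nu_zero_smul, map_zero]
        · obtain ⟨ψ, hψ⟩ := exists_stdModule_equiv_inr (A := A) (B := B) hU hT hΛ hUM j' t'
          exact .inl ⟨(j', t'), ⟨Sum.Lex.inr_lt_inr_iff.1 hp.1, ht⟩, ψ,
            fun r x => hψ (inT U T M r) x⟩
  · rintro ⟨h, h'⟩
    refine h.extension h' φM hMi TriMat.u hMl π (fun y => ⟨φT y, rfl⟩) TriMat.t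
      (fun r x => rfl) ?_ (fun p hp => ?_) fun p hp => ?_
    · refine le_antisymm ?_ fun x hx => ?_
      · rintro _ ⟨m, rfl⟩
        rfl
      · have ht : (x.1.1 : TriMat T M U).t = 0 :=
          congrArg (fun y : (lowerTrace f B j t).Carrier => (y.1.1 : T)) hx
        refine ⟨⟨_, (hmem x).1⟩, Subtype.ext (Subtype.ext ?_)⟩
        rw [hM1]
        ext <;> simp [ht, (hmem x).2]
    · exact ⟨(toLex (Sum.inl p.1), Sum.inl p.2), ⟨Sum.Lex.inl_lt_inr _ _, p.2, hp, rfl⟩,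
        exists_stdModule_equiv_inl hU hΛ p.1 p.2⟩
    · exact ⟨(toLex (Sum.inr p.1), Sum.inr p.2),
        ⟨Sum.Lex.inr_lt_inr_iff.2 hp.1, p.2, hp.2, rfl⟩,
        exists_stdModule_equiv_inr hU hT hΛ hUM p.1 p.2⟩

/-- The two preceding equivalences, collected over all blocks. -/
theorem isLeftStdStratified_iff (hU : HasEnoughIdempotents e) (hT : HasEnoughIdempotents f)
    (hUM : IsUnitary U M) (hMT : IsUnitary Tᵐᵒᵖ M) :
    IsLeftStdStratified (idem M e f) (A.join B) ↔
      (∀ j, IsGood e A (colSubmodule U M (f j)).Carrier) ∧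
        IsLeftStdStratified f B ∧ IsLeftStdStratified e A := by
  have hΛ := hasEnoughIdempotents hU hT hUM hMT
  constructor
  · intro h
    refine ⟨fun t => ?_, fun j t ht => ?_, fun i t ht => ?_⟩
    · obtain ⟨j, ht⟩ := B.exists_mem_block t
      exact ((isGoodBelow_lowerTrace_inr_iff hU hT hΛ hUM j t).1
        (h (toLex (Sum.inr j)) (Sum.inr t) ⟨t, ht, rfl⟩)).1
    · exact ((isGoodBelow_lowerTrace_inr_iff hU hT hΛ hUM j t).1
        (h (toLex (Sum.inr j)) (Sum.inr t) ⟨t, ht, rfl⟩)).2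
    · exact (isGoodBelow_lowerTrace_inl_iff hU hΛ i t).1
        (h (toLex (Sum.inl i)) (Sum.inl t) ⟨t, ht, rfl⟩)
  · rintro ⟨hM, hTs, hUs⟩ k r hr
    rcases OrdPartition.mem_join_block (p := (k, r)) hr with ⟨i, t, ht, h⟩ | ⟨j, t, ht, h⟩ <;>
      obtain ⟨rfl, rfl⟩ := Prod.mk.inj h
    · exact (isGoodBelow_lowerTrace_inl_iff hU hΛ i t).2 (hUs i t ht)
    · exact (isGoodBelow_lowerTrace_inr_iff hU hT hΛ hUM j t).2 ⟨hM t, hTs j t ht⟩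

end TriMat

end EnoughIdem

theorem theorem3p10
    {K U T M I J : Type*} [CommRing K]
    -- the `K`-algebras `U` and `T`, not necessarily with unit
    [NonUnitalRing U] [Module K U] [IsScalarTower K U U] [SMulCommClass K U U]
    [NonUnitalRing T] [Module K T] [IsScalarTower K T T] [SMulCommClass K T T]
    -- the `U`-`T`-bimodule `M`, on which `K` acts centrally
    [AddCommGroup M] [Module K M] [NUModule U M] [NUModule Tᵐᵒᵖ M] [SMulCommClass U Tᵐᵒᵖ M]
    [IsScalarTower K U M] [SMulCommClass K U M]
    [IsScalarTower K Tᵐᵒᵖ M] [SMulCommClass K Tᵐᵒᵖ M]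
    (e : I → U) (f : J → T) (hU : IsBasic K e) (hT : IsBasic K f)
    (hUM : IsUnitary U M) (hMT : IsUnitary Tᵐᵒᵖ M)
    (hM : ∀ i j, IsFiniteLength K (bimoduleCorner K M (e i) (f j)))
    (α : Ordinal.{w₁}) (β : Ordinal.{w₂})
    (A : OrdPartition I (Set.Iio α)) (B : OrdPartition J (Set.Iio β)) :
    IsBasic K (TriMat.idem M e f) ∧
    (IsLeftStdStratified (TriMat.idem M e f) (A.join B) ↔
      (∀ j, IsGood e A (colSubmodule U M (f j)).Carrier) ∧
        IsLeftStdStratified f B ∧ IsLeftStdStratified e A) := by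
  exact ⟨TriMat.isBasic hU hT hUM hMT hM, TriMat.isLeftStdStratified_iff
    hU.toHasEnoughIdempotents hT.toHasEnoughIdempotents hUM hMT⟩
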